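/- **Setup.** Let $\pi\in(0,1)$. For each sequence length $L$ let $d=d_L$ be an embedding dimension, $\xi=\xi_L\in\mathbb{R}^{d}$ with $\|\xi\|=1$, $\theta=\theta_L>0$ and $R=R_L\in\mathbb{N}$. A sample $(X,y)$ with $X\in\mathbb{R}^{L\times d}$ (rows $X^1,\dots,X^L$ are the tokens) and $y\in\{-1,+1\}$ is drawn as follows: $\mathbb{P}(y=1)=\pi$; given $y=-1$, $X=Z$; given $y=1$, $X=\theta v\xi^\top+Z$. Here $Z\in\mathbb{R}^{L\times d}$ has i.i.d. standard normal entries, and $v\in\{0,1\}^L$, independent of $Z$, is the indicator vector of a random subset of $\{1,\dots,L\}$ which (for all large $L$) has cardinality $R$ and otherwise an arbitrary law whose marginals $p_j=\mathbb{P}(v_j=1)$ satisfy $\|p\|=O(R/\sqrt{L})$ as $L\to\infty$. Let $\varphi:\mathbb{R}\to[0,\infty)$ be continuous and non-decreasing with $\varphi(0)>0$, $\lim_{x\to-\infty}\varphi(x)=0$ and $\lim_{x\to\infty}\varphi(x)=1$. The approximate attention model with parameters $q,w\in\mathbb{R}^d$, $b\in\mathbb{R}$ is $$\widetilde{\mathsf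 A}_{q,w,b}(X)=\mathrm{sign}\big(\langle X^\top\varphi(Xq),w\rangle+b\big),$$ with $\varphi$ applied elementwise, and its optimal test error is $$\mathcal{E}^\ast_{\mathsf{test}}[\widetilde{\mathsf A}]=\inf_{q,w,b}\ \mathbb{P}_{X,y}\big[\widetilde{\mathsf A}_{q,w,b}(X)\neq y\big].$$ **Proposition.** (a) Suppose that the limit $\mathsf{SNR}:=\lim_{L\to\infty}\theta R/\sqrt{L}$ exists in $[0,\infty]$. Then $$\lim_{L\to\infty}\mathcal{E}^\ast_{\mathsf{test}}[\widetilde{\mathsf A}]=\begin{cases}0&\text{if }\mathsf{SNR}=\infty,\\ \min(\pi,1-\pi)&\text{if }\mathsf{SNR}=0.\end{cases}$$ (b) Consequently a strong signal is necessary for perfect classification of sparse signals: if $R=O(1)$ and $\mathcal{E}^\ast_{\mathsf{test}}[\widetilde{\mathsf A}]\to0$ as $L\to\infty$, then $\theta=\Omega(\sqrt{L})$, i.e. $\sqrt{L}=O(\theta)$. -/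

import Mathlib

open Filter Topology MeasureTheory ProbabilityTheory
open scoped Matrix BigOperators

noncomputable section

namespace SparseToken

/-- Sequences of `L` tokens embedded in dimension `d`; the rows are the tokens. -/
abbrev Tokens (L d : ℕ) : Type := Fin L → Fin d → ℝ

/-- The law of a token matrix with i.i.d. standard normal entries. -/
def noiseLaw (L d : ℕ) : Measure (Tokens L d) :=
  Measure.pi fun _ : Fin L => Measure.pi fun _ : Fin d => gaussianReal 0 1

/-- The binary vector indicating the location of the informative tokens. -/
def indicatorVec {L : ℕ} (S : Finset (Fin L)) : Fin L → ℝ :=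
  fun k => if k ∈ S then 1 else 0

/-- The marginals `p_k = P(v_k = 1)` of the random indicator vector `v`, when the random set of
informative tokens has law `ν`, as a vector of Euclidean space. -/
def marginals {L : ℕ} (ν : PMF (Finset (Fin L))) : EuclideanSpace ℝ (Fin L) :=
  WithLp.toLp 2 fun k => ∑ S : Finset (Fin L) with k ∈ S, (ν S).toReal

/-- The joint law of a sample `(X, y)`. With probability `1 - prob` the label is `-1` and `X = Z`
is pure noise; with probability `prob` the label is `1` and `X = θ v ξᵀ + Z`, where `v` is the
indicator vector of a random set of tokens with law `ν`, independent of the noise `Z`. -/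
def sampleLaw {L d : ℕ} (prob θ : ℝ) (ξ : EuclideanSpace ℝ (Fin d))
    (ν : PMF (Finset (Fin L))) : Measure (Tokens L d × ℝ) :=
  ENNReal.ofReal (1 - prob) • (noiseLaw L d).map (fun Z => (Z, (-1 : ℝ))) +
    ENNReal.ofReal prob • ∑ S : Finset (Fin L),
      ν S • (noiseLaw L d).map
        (fun Z => (θ • Matrix.of.symm (Matrix.vecMulVec (indicatorVec S) ξ.ofLp) + Z, (1 : ℝ)))

/-- The misclassification probability `P(ŷ(X) ≠ y)` of a predictor `ŷ` under the law `μ` of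
`(X, y)`. -/
def testError {𝒳 : Type} [MeasurableSpace 𝒳] (μ : Measure (𝒳 × ℝ)) (yhat : 𝒳 → ℝ) : ℝ :=
  μ.real {s | yhat s.1 ≠ s.2}

/-- The optimal test error of a class of predictors parametrized by `W`. -/
def optimalTestError {𝒳 𝒲 : Type} [MeasurableSpace 𝒳] (μ : Measure (𝒳 × ℝ))
    (yhat : 𝒲 → 𝒳 → ℝ) : ℝ :=
  ⨅ W : 𝒲, testError μ (yhat W)

/-- The features `Xᵀ φ(X q)`, with `φ` applied entrywise. -/
def approxFeature {L d : ℕ} (φ : ℝ → ℝ) (q : Fin d → ℝ) (X : Tokens L d) : Fin d → ℝ :=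
  (Matrix.of X)ᵀ *ᵥ fun k => φ ((Matrix.of X *ᵥ q) k)

/-- The approximate attention classifier `sign(⟨Xᵀ φ(X q), w⟩ + b)` with parameters
`(q, w, b)`. -/
def approxAttention {L d : ℕ} (φ : ℝ → ℝ)
    (W : (Fin d → ℝ) × (Fin d → ℝ) × ℝ) (X : Tokens L d) : ℝ :=
  Real.sign (approxFeature φ W.1 X ⬝ᵥ W.2.1 + W.2.2)

/-- The optimal test error of the approximate attention model on the sparse token classification
task: the infimum over all `(q, w, b)` of the misclassification probability. -/
def approxAttentionError {L d : ℕ} (φ : ℝ → ℝ) (prob θ : ℝ) (ξ : EuclideanSpace ℝ (Fin d))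
    (ν : PMF (Finset (Fin L))) : ℝ :=
  optimalTestError (sampleLaw prob θ ξ ν) (approxAttention φ)

end SparseToken

end

/-! Given the parameters, the classifier thresholds a sum of one score per token, `φ (z ⬝ᵥ q) * (z
⬝ᵥ w)`. When `θ R ≫ √L`, take `q = 0`, `w = ξ`. All attention weights equal `φ 0`, the signal moves
the sum by `φ 0 * θ R`, and the noise has standard deviation `φ 0 * √L`, so a midpoint threshold
succeeds by Chebyshev (`approxAttentionError_le`).

When `θ R ≪ √L`, no parameters help, uniformly in `d`, `q`, `w` and the threshold, because two
scales are separated. By homogeneity take `w` to be a unit vector. (1) The signal moves the score by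
at most `4 θ R` in mean (`integral_abs_score_add_signal_sub_le`). (2) The pure noise score puts
little mass on any window of width of order `ε √L` (`noiseLaw_score_sub_le`). Translating every
token by `± (ε / √L) w` changes the noise law by only `O(ε)` in total variation, yet with high
probability it separates the scores by more than that width. A window of large mass would contradict
this. Markov's inequality then shows that signal and noise samples fall below any threshold with
almost the same probability `p`, so the error is nearly `(1 - π)(1 - p) + π p ≥ min π (1 - π)`.
Constant predictors attain this value.

Smoothness of `φ` is replaced throughout by Gaussian smoothing: translations are moved onto the
density (`IsCameronMartin`), and monotonicity fixes the sign of the increments of `φ`. Part (b) is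
the weak signal limit along a subsequence with `θ / √L → 0`. -/

namespace SparseToken

/-! ### Translates of Gaussian measures: densities and `χ²` bounds. -/

/-- Cauchy–Schwarz inequality for integrals of real functions. -/
theorem abs_integral_mul_le_sqrt_mul_sqrt {Ω : Type*} [MeasurableSpace Ω] {μ : Measure Ω}
    {f g : Ω → ℝ} (hf : MemLp f 2 μ) (hg : MemLp g 2 μ) :
    |∫ x, f x * g x ∂μ| ≤ √(∫ x, f x ^ 2 ∂μ) * √(∫ x, g x ^ 2 ∂μ) := by
  have hff := hf.integrable_sq
  have hgg := hg.integrable_sq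
  have hfg : Integrable (fun x => f x * g x) μ := hf.integrable_mul hg
  have key : ∀ t : ℝ, 0 ≤ (∫ x, g x ^ 2 ∂μ) * (t * t) + (2 * ∫ x, f x * g x ∂μ) * t
      + ∫ x, f x ^ 2 ∂μ := by
    intro t
    have h0 : 0 ≤ ∫ x, (f x + t * g x) ^ 2 ∂μ := integral_nonneg fun x => sq_nonneg _
    have h1 : ∫ x, (f x + t * g x) ^ 2 ∂μ
        = ∫ x, (f x ^ 2 + (2 * t) * (f x * g x) + (t * t) * g x ^ 2) ∂μ :=
      integral_congr_ae (.of_forall fun x => by ring)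
    have i1 : Integrable (fun x => f x ^ 2 + (2 * t) * (f x * g x)) μ := hff.add (hfg.const_mul _)
    rw [h1, integral_add i1 (hgg.const_mul _), integral_add hff (hfg.const_mul _), integral_const_mul, integral_const_mul] at h0
    linarith
  have hd := discrim_le_zero key
  rw [discrim] at hd
  rw [← Real.sqrt_mul (integral_nonneg fun x => sq_nonneg _)]
  exact Real.abs_le_sqrt (by linarith)

/-- A measure `γ` whose translate by `m` has density `exp (B m z - B m m / 2)`. -/
structure IsCameronMartin {E : Type*} [MeasurableSpace E] [AddGroup E] (γ : Measure E)
    (B : E → E → ℝ) : Prop where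
  measurable_pairing : ∀ m, Measurable (B m)
  double_left : ∀ m z, B (m + m) z = 2 * B m z
  double_right : ∀ m z, B z (m + m) = 2 * B z m
  map_add : ∀ m, γ.map (fun z => z + m) =
    γ.withDensity fun z => ENNReal.ofReal (Real.exp (B m z - B m m / 2))

theorem isCameronMartin_gaussianReal : IsCameronMartin (gaussianReal 0 1) fun x y => x * y where
  measurable_pairing m := by fun_prop
  double_left m z := by ring
  double_right m z := by ring
  map_add m := by
    rw [gaussianReal_map_add_const, gaussianReal_of_var_ne_zero _ one_ne_zero,
      gaussianReal_of_var_ne_zero _ one_ne_zero,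
      ← withDensity_mul _ (measurable_gaussianPDF _ _) (by fun_prop)]
    congr 1
    ext z
    simp only [Pi.mul_apply, gaussianPDF, gaussianPDFReal]
    rw [← ENNReal.ofReal_mul (by positivity), mul_assoc _ (Real.exp _), ← Real.exp_add]
    congr 3
    simp only [NNReal.coe_one]
    ring

/-- A finite product of measures with densities has the product density. -/
theorem pi_withDensity {ι : Type*} [Fintype ι] {E : Type*} [MeasurableSpace E] {γ : Measure E}
    [IsProbabilityMeasure γ] {f : ι → E → ENNReal} (hf : ∀ i, Measurable (f i))
    [∀ i, SigmaFinite (γ.withDensity (f i))] :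
    Measure.pi (fun i => γ.withDensity (f i)) =
      (Measure.pi fun _ : ι => γ).withDensity fun z => ∏ i, f i (z i) := by
  refine Measure.pi_eq fun s hs => ?_
  rw [withDensity_apply _ (MeasurableSet.univ_pi hs),
    ← lintegral_indicator (MeasurableSet.univ_pi hs)]
  have h1 : ∀ z : ι → E, (Set.univ.pi s).indicator (fun z => ∏ i, f i (z i)) z
      = ∏ i, (s i).indicator (f i) (z i) := by
    intro z
    by_cases hz : z ∈ Set.univ.pi s
    · rw [Set.indicator_of_mem hz]
      exact Finset.prod_congr rfl fun i _ => by rw [Set.indicator_of_mem (hz i trivial)]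
    · rw [Set.indicator_of_notMem hz]
      simp only [Set.mem_univ_pi, not_forall] at hz
      obtain ⟨i, hi⟩ := hz
      exact (Finset.prod_eq_zero (Finset.mem_univ i) (Set.indicator_of_notMem hi _)).symm
  simp_rw [h1]
  have hm : ∀ i, Measurable ((s i).indicator (f i)) := fun i => (hf i).indicator (hs i)
  have h2 := lintegral_prod_eq_prod_lintegral_of_indepFun (μ := Measure.pi fun _ : ι => γ)
    Finset.univ (fun i (z : ι → E) => (s i).indicator (f i) (z i))
    (iIndepFun_pi fun i => (hm i).aemeasurable)
    (fun i => (hm i).comp (measurable_pi_apply i))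
  rw [h2]
  refine Finset.prod_congr rfl fun i _ => ?_
  rw [withDensity_apply _ (hs i), ← lintegral_indicator (hs i)]
  have h3 := (measurePreserving_eval (fun _ : ι => γ) i).lintegral_comp (hm i)
  exact h3

namespace IsCameronMartin

variable {E : Type*} [MeasurableSpace E] [AddCommGroup E] {γ : Measure E} {B : E → E → ℝ}

/-- Squaring the density for `m` gives a multiple of the density for `m + m`, so second moments
reduce to total masses. Only the doubling rules for `B` are needed, not bilinearity. -/
theorem density_sq (h : IsCameronMartin γ B) (m z : E) :
    Real.exp (B m z - B m m / 2) ^ 2 =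
      Real.exp (B m m) * Real.exp (B (m + m) z - B (m + m) (m + m) / 2) := by
  rw [h.double_left, h.double_right, h.double_left, ← Real.exp_nat_mul, ← Real.exp_add]
  congr 1
  push_cast
  ring

variable [MeasurableAdd E]

theorem integral_add (h : IsCameronMartin γ B) (m : E) {G : E → ℝ} (hG : Measurable G) :
    ∫ z, G (z + m) ∂γ = ∫ z, Real.exp (B m z - B m m / 2) * G z ∂γ := by
  have hB := h.measurable_pairing m
  rw [← integral_map (φ := fun z => z + m) (by fun_prop) hG.aestronglyMeasurable, h.map_add,
    integral_withDensity_eq_integral_toReal_smul (by fun_prop) (.of_forall fun _ => by simp)]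
  simp [ENNReal.toReal_ofReal, (Real.exp_pos _).le]

theorem integrable_add_iff (h : IsCameronMartin γ B) (m : E) {G : E → ℝ} (hG : Measurable G) :
    Integrable (fun z => G (z + m)) γ ↔
      Integrable (fun z => Real.exp (B m z - B m m / 2) * G z) γ := by
  have hB := h.measurable_pairing m
  have h1 := integrable_map_measure (μ := γ) (f := fun z => z + m)
    hG.aestronglyMeasurable (by fun_prop)
  rw [show (fun z => G (z + m)) = G ∘ fun z => z + m from rfl, ← h1, h.map_add,
    integrable_withDensity_iff_integrable_smul' (by fun_prop) (.of_forall fun _ => by simp)]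
  simp [ENNReal.toReal_ofReal, (Real.exp_pos _).le]

variable [IsProbabilityMeasure γ]

/-- Densities multiply over independent factors, so exponents add. It is used over the coordinates
of a token and again over the tokens. -/
theorem pi (h : IsCameronMartin γ B) (ι : Type*) [Fintype ι] :
    IsCameronMartin (Measure.pi fun _ : ι => γ) fun x y => ∑ i, B (x i) (y i) where
  measurable_pairing m := by
    have := h.measurable_pairing
    exact Finset.measurable_sum _ fun i _ => (this _).comp (measurable_pi_apply i)
  double_left m z := by simp [h.double_left, Finset.mul_sum]
  double_right m z := by simp [h.double_right, Finset.mul_sum]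
  map_add m := by
    have hprob : ∀ i, IsProbabilityMeasure (γ.map fun z => z + m i) := fun i =>
      Measure.isProbabilityMeasure_map (by fun_prop)
    have h1 := Measure.pi_map_pi (μ := fun _ : ι => γ) (f := fun i z => z + m i)
      (fun i => by fun_prop)
    have h2 : (fun (z : ι → E) => z + m) = fun z i => z i + m i := rfl
    rw [h2, h1]
    simp_rw [h.map_add] at hprob ⊢
    rw [pi_withDensity fun i => by
      have := h.measurable_pairing (m i)
      fun_prop]
    congr 1
    ext z
    rw [← ENNReal.ofReal_prod_of_nonneg fun i _ => (Real.exp_pos _).le, ← Real.exp_sum,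
      Finset.sum_sub_distrib, Finset.sum_div]

theorem integrable_density (h : IsCameronMartin γ B) (m : E) :
    Integrable (fun z => Real.exp (B m z - B m m / 2)) γ := by
  simpa using (h.integrable_add_iff m (G := fun _ => 1) measurable_const).1 (integrable_const _)

theorem integral_density (h : IsCameronMartin γ B) (m : E) :
    ∫ z, Real.exp (B m z - B m m / 2) ∂γ = 1 := by
  simpa using (h.integral_add m (G := fun _ => 1) measurable_const).symm

theorem memLp_density (h : IsCameronMartin γ B) (m : E) :
    MemLp (fun z => Real.exp (B m z - B m m / 2)) 2 γ := by
  rw [memLp_two_iff_integrable_sq (h.integrable_density m).aestronglyMeasurable]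
  simp_rw [h.density_sq]
  exact (h.integrable_density _).const_mul _

theorem integral_density_sub_one_sq (h : IsCameronMartin γ B) (m : E) :
    ∫ z, (Real.exp (B m z - B m m / 2) - 1) ^ 2 ∂γ = Real.exp (B m m) - 1 := by
  have h1 : ∀ z, (Real.exp (B m z - B m m / 2) - 1) ^ 2 =
      Real.exp (B m m) * Real.exp (B (m + m) z - B (m + m) (m + m) / 2)
        - 2 * Real.exp (B m z - B m m / 2) + 1 := fun z => by
    rw [← h.density_sq]; ring
  simp_rw [h1]
  have i1 := (h.integrable_density (m + m)).const_mul (Real.exp (B m m))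
  have i2 := (h.integrable_density m).const_mul 2
  have i3 : Integrable (fun z =>
      Real.exp (B m m) * Real.exp (B (m + m) z - B (m + m) (m + m) / 2)
        - 2 * Real.exp (B m z - B m m / 2)) γ := i1.sub i2
  rw [MeasureTheory.integral_add i3 (integrable_const _), integral_sub i1 i2,
    integral_const_mul, integral_const_mul, h.integral_density, h.integral_density]
  simp
  ring

/-- Translating by `m` changes the integral of `G` by at most the `L²` norm of `G` times the
`χ²` distance between the measure and its translate. -/
theorem abs_integral_add_sub_le (h : IsCameronMartin γ B) (m : E) {G : E → ℝ} (hG : Measurable G)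
    (hG2 : MemLp G 2 γ) :
    |∫ z, G (z + m) ∂γ - ∫ z, G z ∂γ| ≤
      √(∫ z, G z ^ 2 ∂γ) * √(Real.exp (B m m) - 1) := by
  have i1 : Integrable (fun z => Real.exp (B m z - B m m / 2) * G z) γ :=
    (h.memLp_density m).integrable_mul hG2
  rw [h.integral_add m hG, ← integral_sub i1 (hG2.integrable one_le_two),
    ← h.integral_density_sub_one_sq, mul_comm]
  have h1 := abs_integral_mul_le_sqrt_mul_sqrt
    ((h.memLp_density m).sub (memLp_const (1 : ℝ))) hG2
  simp only [Pi.sub_apply, sub_mul, one_mul] at h1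
  exact h1

/-- The `L²` shift bound for an indicator, whose `L²` norm is at most one. -/
theorem abs_measureReal_preimage_sub_le (h : IsCameronMartin γ B) (m : E) {A : Set E}
    (hA : MeasurableSet A) :
    |γ.real {z | z + m ∈ A} - γ.real A| ≤ √(Real.exp (B m m) - 1) := by
  have hm : Measurable (A.indicator (1 : E → ℝ)) := measurable_one.indicator hA
  have hA' : MeasurableSet {z | z + m ∈ A} := (measurable_add_const m) hA
  have h1 := h.abs_integral_add_sub_le m hm
    (MemLp.indicator hA (memLp_const (1 : ℝ)))
  have e1 : ∀ z, A.indicator (1 : E → ℝ) (z + m) = {z | z + m ∈ A}.indicator 1 z := fun z => rfl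
  have e2 : ∀ z, A.indicator (1 : E → ℝ) z ^ 2 = A.indicator 1 z := fun z => by
    by_cases hz : z ∈ A <;> simp [hz]
  simp_rw [e1, e2] at h1
  rw [integral_indicator_one hA, integral_indicator_one hA'] at h1
  refine h1.trans (mul_le_of_le_one_left (Real.sqrt_nonneg _) ?_)
  exact Real.sqrt_le_one.2 measureReal_le_one

end IsCameronMartin

/-! ### The standard Gaussian vector and its one-dimensional projections. -/

/-- The standard Gaussian measure on `ℝ^d`. -/
noncomputable abbrev gaussianPi (d : ℕ) : Measure (Fin d → ℝ) :=
  Measure.pi fun _ : Fin d => gaussianReal 0 1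

variable {d : ℕ}

theorem isCameronMartin_gaussianPi (d : ℕ) :
    IsCameronMartin (gaussianPi d) fun x y => x ⬝ᵥ y :=
  isCameronMartin_gaussianReal.pi (Fin d)

@[fun_prop]
theorem measurable_dotProduct_right (w : Fin d → ℝ) : Measurable fun z : Fin d → ℝ => z ⬝ᵥ w := by
  unfold dotProduct
  fun_prop

/-- A sum of independent Gaussians with total variance `w ⬝ᵥ w`. Moments along a unit direction thus
become one-dimensional constants, free of `d`. -/
theorem measurePreserving_dotProduct {w : Fin d → ℝ} (hw : w ⬝ᵥ w = 1) :
    MeasurePreserving (fun z : Fin d → ℝ => z ⬝ᵥ w) (gaussianPi d) (gaussianReal 0 1) := by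
  refine ⟨by fun_prop, ?_⟩
  have hL : ∀ i : Fin d, MemLp (fun x : ℝ => x * w i) 2 (gaussianReal 0 1) := fun i =>
    (memLp_id_gaussianReal' 2 (by simp)).mul_const (w i)
  have hG : HasGaussianLaw (fun z : Fin d → ℝ => ∑ i, z i * w i) (gaussianPi d) := by
    refine iIndepFun.hasGaussianLaw_fun_sum (X := fun i (z : Fin d → ℝ) => z i * w i)
      (fun i => ?_) (iIndepFun_pi (X := fun i (x : ℝ) => x * w i) fun i => by fun_prop)
    have h1 : HasLaw (fun z : Fin d → ℝ => z i) (gaussianReal 0 1) (gaussianPi d) :=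
      ⟨(measurable_pi_apply i).aemeasurable,
        (measurePreserving_eval (fun _ : Fin d => gaussianReal 0 1) i).map_eq⟩
    exact (gaussianReal_mul_const h1 (w i)).hasGaussianLaw
  have hmean : ∫ z : Fin d → ℝ, ∑ i, z i * w i ∂(gaussianPi d) = 0 := by
    rw [integral_finsetSum _ fun i _ =>
      integrable_comp_eval (μ := fun _ : Fin d => gaussianReal 0 1) (i := i)
        ((hL i).integrable one_le_two)]
    refine Finset.sum_eq_zero fun i _ => ?_
    rw [integral_comp_eval (μ := fun _ : Fin d => gaussianReal 0 1) (i := i)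
      (f := fun x => x * w i) (by fun_prop), integral_mul_const, integral_id_gaussianReal, zero_mul]
  have hvar : Var[fun z : Fin d → ℝ => ∑ i, z i * w i; gaussianPi d] = 1 := by
    have h1 := variance_sum_pi (μ := fun _ : Fin d => gaussianReal 0 1) hL
    have h2 : (∑ i, fun z : Fin d → ℝ => z i * w i) = fun z => ∑ i, z i * w i := by
      ext z; simp
    rw [h2] at h1
    rw [h1, ← hw]
    refine Finset.sum_congr rfl fun i _ => ?_
    rw [variance_mul_const, variance_fun_id_gaussianReal]
    simp [sq]
  have h := hG.map_eq_gaussianReal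
  rw [hmean, hvar] at h
  simpa [dotProduct] using h

section Moments

variable {w : Fin d → ℝ}

theorem memLp_comp_dotProduct (hw : w ⬝ᵥ w = 1) {H : ℝ → ℝ} {p : ENNReal}
    (hH : MemLp H p (gaussianReal 0 1)) : MemLp (fun z => H (z ⬝ᵥ w)) p (gaussianPi d) :=
  hH.comp_measurePreserving (measurePreserving_dotProduct hw)

theorem integral_comp_dotProduct (hw : w ⬝ᵥ w = 1) {H : ℝ → ℝ} (hH : Measurable H) :
    ∫ z, H (z ⬝ᵥ w) ∂(gaussianPi d) = ∫ x, H x ∂(gaussianReal 0 1) := by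
  rw [← (measurePreserving_dotProduct hw).map_eq,
    integral_map (by fun_prop) hH.aestronglyMeasurable]

theorem memLp_dotProduct (hw : w ⬝ᵥ w = 1) : MemLp (fun z => z ⬝ᵥ w) 2 (gaussianPi d) :=
  memLp_comp_dotProduct (H := id) hw (memLp_id_gaussianReal' 2 (by simp))

theorem memLp_sq_gaussianReal : MemLp (fun x : ℝ => x ^ 2) 2 (gaussianReal 0 1) := by
  rw [memLp_two_iff_integrable_sq (by fun_prop)]
  have h := (memLp_id_gaussianReal' (μ := 0) (v := 1) 4 (by simp)).integrable_norm_pow (by norm_num)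
  refine h.congr (.of_forall fun x => ?_)
  simp only [id, Real.norm_eq_abs]
  rw [Even.pow_abs (by decide)]
  ring

theorem integral_sq_gaussianReal : ∫ x, x ^ 2 ∂(gaussianReal 0 1) = 1 := by
  have h := variance_fun_id_gaussianReal (μ := 0) (v := 1)
  rw [variance_of_integral_eq_zero (by fun_prop) integral_id_gaussianReal] at h
  simpa using h

theorem integral_sq_dotProduct (hw : w ⬝ᵥ w = 1) : ∫ z, (z ⬝ᵥ w) ^ 2 ∂(gaussianPi d) = 1 := by
  rw [integral_comp_dotProduct (H := fun x => x ^ 2) hw (by fun_prop), integral_sq_gaussianReal]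

theorem integral_abs_dotProduct_le (hw : w ⬝ᵥ w = 1) :
    ∫ z, |z ⬝ᵥ w| ∂(gaussianPi d) ≤ 1 := by
  have h := abs_integral_mul_le_sqrt_mul_sqrt (memLp_dotProduct hw).abs
    (memLp_const (μ := gaussianPi d) (1 : ℝ))
  simp only [Pi.abs_apply, mul_one, sq_abs, integral_sq_dotProduct hw] at h
  simpa using (le_abs_self _).trans h

end Moments

theorem abs_dotProduct_le_one {u w : Fin d → ℝ} (hu : u ⬝ᵥ u = 1) (hw : w ⬝ᵥ w = 1) :
    |u ⬝ᵥ w| ≤ 1 := by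
  have h1 : 0 ≤ (u - w) ⬝ᵥ (u - w) := Finset.sum_nonneg fun i _ => mul_self_nonneg _
  have h2 : 0 ≤ (u + w) ⬝ᵥ (u + w) := Finset.sum_nonneg fun i _ => mul_self_nonneg _
  simp only [sub_dotProduct, dotProduct_sub, add_dotProduct, dotProduct_add, hu, hw,
    dotProduct_comm w u] at h1 h2
  exact abs_le.2 ⟨by linarith, by linarith⟩

theorem sqrt_exp_sq_sub_one_le {t : ℝ} (h0 : 0 ≤ t) (h1 : t ≤ 1) :
    √(Real.exp (t ^ 2) - 1) ≤ 2 * t := by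
  refine Real.sqrt_le_iff.2 ⟨by linarith, ?_⟩
  have h2 : t ^ 2 ≤ 1 := by nlinarith
  have h := Real.abs_exp_sub_one_le (x := t ^ 2) (by rwa [abs_of_nonneg (sq_nonneg t)])
  rw [abs_of_nonneg (sq_nonneg t)] at h
  nlinarith [le_abs_self (Real.exp (t ^ 2) - 1), sq_nonneg t]

/-! ### The score of one token under translation: mean and mean square increments. -/

/-- The contribution of a single token to the output of the approximate attention model. -/
def tokenScore (φ : ℝ → ℝ) (q w z : Fin d → ℝ) : ℝ := φ (z ⬝ᵥ q) * (z ⬝ᵥ w)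

section TokenScore

variable {φ : ℝ → ℝ} {q w : Fin d → ℝ}

theorem measurable_tokenScore (hφ : Monotone φ) : Measurable (tokenScore φ q w) := by
  have := hφ.measurable
  unfold tokenScore
  fun_prop

theorem memLp_tokenScore_add (hφ : Monotone φ) (h0 : ∀ x, 0 ≤ φ x) (h1 : ∀ x, φ x ≤ 1)
    (hw : w ⬝ᵥ w = 1) (m : Fin d → ℝ) :
    MemLp (fun z => tokenScore φ q w (z + m)) 2 (gaussianPi d) := by
  have hm : Measurable fun z => tokenScore φ q w (z + m) :=
    (measurable_tokenScore hφ).comp (measurable_add_const m)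
  refine ((memLp_dotProduct hw).add (memLp_const (m ⬝ᵥ w))).mono hm.aestronglyMeasurable
    (.of_forall fun z => ?_)
  simp only [tokenScore, Pi.add_apply, add_dotProduct, Real.norm_eq_abs, abs_mul,
    abs_of_nonneg (h0 _)]
  exact mul_le_of_le_one_left (abs_nonneg _) (h1 _)

theorem memLp_tokenScore (hφ : Monotone φ) (h0 : ∀ x, 0 ≤ φ x) (h1 : ∀ x, φ x ≤ 1)
    (hw : w ⬝ᵥ w = 1) : MemLp (tokenScore φ q w) 2 (gaussianPi d) := by
  simpa using memLp_tokenScore_add (q := q) hφ h0 h1 hw 0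

/-- A monotone bounded attention weight moves little, on average, under a translation. -/
theorem integral_abs_sub_mul_le (hφ : Monotone φ) (h0 : ∀ x, 0 ≤ φ x) (h1 : ∀ x, φ x ≤ 1)
    (hw : w ⬝ᵥ w = 1) {H : ℝ → ℝ} (hH : Measurable H) (hH0 : ∀ x, 0 ≤ H x)
    (hH2 : MemLp H 2 (gaussianReal 0 1)) {m : Fin d → ℝ} {a b : ℝ} (ha : 0 ≤ a)
    (hab : ∀ x, |H (x + m ⬝ᵥ w) - H x| ≤ a * |x| + b) :
    Integrable (fun z => |φ ((z + m) ⬝ᵥ q) - φ (z ⬝ᵥ q)| * H (z ⬝ᵥ w)) (gaussianPi d) ∧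
    ∫ z, |φ ((z + m) ⬝ᵥ q) - φ (z ⬝ᵥ q)| * H (z ⬝ᵥ w) ∂(gaussianPi d) ≤
      a + b + √(∫ x, H x ^ 2 ∂(gaussianReal 0 1)) * √(Real.exp (m ⬝ᵥ m) - 1) := by
  have hφm := hφ.measurable
  have hHw : MemLp (fun z => H (z ⬝ᵥ w)) 2 (gaussianPi d) := memLp_comp_dotProduct hw hH2
  set G : (Fin d → ℝ) → ℝ := fun z => φ (z ⬝ᵥ q) * H (z ⬝ᵥ w) with hG
  have hGm : Measurable G := by fun_prop
  have hG2 : MemLp G 2 (gaussianPi d) := by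
    refine hHw.mono hGm.aestronglyMeasurable (.of_forall fun z => ?_)
    rw [Real.norm_of_nonneg (mul_nonneg (h0 _) (hH0 _)), Real.norm_of_nonneg (hH0 _)]
    exact mul_le_of_le_one_left (hH0 _) (h1 _)
  have hcm := isCameronMartin_gaussianPi d
  have hGi : Integrable (fun z => G (z + m)) (gaussianPi d) :=
    (hcm.integrable_add_iff m hGm).2 ((hcm.memLp_density m).integrable_mul hG2)
  have hle : ∫ z, G z ^ 2 ∂(gaussianPi d) ≤ ∫ x, H x ^ 2 ∂(gaussianReal 0 1) := by
    rw [← integral_comp_dotProduct hw (hH.pow_const 2)]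
    refine integral_mono hG2.integrable_sq hHw.integrable_sq fun z => ?_
    exact pow_le_pow_left₀ (mul_nonneg (h0 _) (hH0 _)) (mul_le_of_le_one_left (hH0 _) (h1 _)) 2
  have hshift := (hcm.abs_integral_add_sub_le m hGm hG2).trans
    (mul_le_mul_of_nonneg_right (Real.sqrt_le_sqrt hle) (Real.sqrt_nonneg _))
  have habs : Integrable (fun z : Fin d → ℝ => |z ⬝ᵥ w|) (gaussianPi d) :=
    ((memLp_dotProduct hw).integrable one_le_two).abs
  have hint : Integrable (fun z => |φ ((z + m) ⬝ᵥ q) - φ (z ⬝ᵥ q)| * H (z ⬝ᵥ w))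
      (gaussianPi d) := by
    refine (hHw.integrable one_le_two).mono (by
      have : Measurable fun z : Fin d → ℝ => φ ((z + m) ⬝ᵥ q) :=
        (hφm.comp (measurable_dotProduct_right q)).comp (measurable_add_const m)
      exact (by fun_prop : Measurable _).aestronglyMeasurable) (.of_forall fun z => ?_)
    rw [Real.norm_of_nonneg (mul_nonneg (abs_nonneg _) (hH0 _)), Real.norm_of_nonneg (hH0 _)]
    refine mul_le_of_le_one_left (hH0 _) (abs_le.2 ⟨?_, ?_⟩) <;>
      linarith [h0 ((z + m) ⬝ᵥ q), h1 ((z + m) ⬝ᵥ q), h0 (z ⬝ᵥ q), h1 (z ⬝ᵥ q)]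
  refine ⟨hint, ?_⟩
  -- By monotonicity the increment of `φ` has the same sign for all `z`, that of `m ⬝ᵥ q`. The
  -- absolute value therefore comes out of the integral, leaving a difference that the shift bound
  -- controls.
  obtain ⟨s, hs, hsφ⟩ : ∃ s : ℝ, |s| = 1 ∧ ∀ z : Fin d → ℝ,
      |φ ((z + m) ⬝ᵥ q) - φ (z ⬝ᵥ q)| = s * (φ ((z + m) ⬝ᵥ q) - φ (z ⬝ᵥ q)) := by
    rcases le_total 0 (m ⬝ᵥ q) with h | h
    · refine ⟨1, by simp, fun z => ?_⟩
      rw [one_mul, abs_of_nonneg (sub_nonneg.2 (hφ (by rw [add_dotProduct]; linarith)))]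
    · refine ⟨-1, by simp, fun z => ?_⟩
      rw [abs_of_nonpos (sub_nonpos.2 (hφ (by rw [add_dotProduct]; linarith)))]
      ring
  -- A discrete product rule: the increment of `φ` times `H` is the increment of `G` minus a term
  -- with the increment of `H`.
  have hpt : ∀ z : Fin d → ℝ, |φ ((z + m) ⬝ᵥ q) - φ (z ⬝ᵥ q)| * H (z ⬝ᵥ w) ≤
      s * (G (z + m) - G z) + (a * |z ⬝ᵥ w| + b) := by
    intro z
    have e : |φ ((z + m) ⬝ᵥ q) - φ (z ⬝ᵥ q)| * H (z ⬝ᵥ w) = s * (G (z + m) - G z)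
        - s * φ ((z + m) ⬝ᵥ q) * (H (z ⬝ᵥ w + m ⬝ᵥ w) - H (z ⬝ᵥ w)) := by
      rw [hsφ, hG]
      simp only [add_dotProduct]
      ring
    rw [e]
    have h2 : |s * φ ((z + m) ⬝ᵥ q) * (H (z ⬝ᵥ w + m ⬝ᵥ w) - H (z ⬝ᵥ w))| ≤
        a * |z ⬝ᵥ w| + b := by
      rw [abs_mul, abs_mul, hs, one_mul, abs_of_nonneg (h0 _)]
      exact (mul_le_of_le_one_left (abs_nonneg _) (h1 _)).trans (hab _)
    linarith [neg_abs_le (s * φ ((z + m) ⬝ᵥ q) * (H (z ⬝ᵥ w + m ⬝ᵥ w) - H (z ⬝ᵥ w)))]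
  have hGG : Integrable (fun z => G (z + m) - G z) (gaussianPi d) :=
    hGi.sub (hG2.integrable one_le_two)
  have hlin : Integrable (fun z : Fin d → ℝ => a * |z ⬝ᵥ w| + b) (gaussianPi d) :=
    (habs.const_mul a).add (integrable_const b)
  refine (integral_mono hint ((hGG.const_mul s).add hlin) hpt).trans ?_
  simp only [Pi.add_apply]
  rw [integral_add (hGG.const_mul s) hlin, integral_add (habs.const_mul a) (integrable_const b),
    integral_const_mul, integral_const_mul, integral_sub hGi (hG2.integrable one_le_two)]
  have h3 := le_abs_self (s * (∫ z, G (z + m) ∂(gaussianPi d) - ∫ z, G z ∂(gaussianPi d)))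
  rw [abs_mul, hs, one_mul] at h3
  have h4 := mul_le_mul_of_nonneg_left (integral_abs_dotProduct_le hw) ha
  simp only [integral_const, probReal_univ, one_smul]
  linarith

/-- On average, a token's score moves by at most a multiple of the length of the translation. -/
theorem integral_abs_tokenScore_add_sub_le (hφ : Monotone φ) (h0 : ∀ x, 0 ≤ φ x)
    (h1 : ∀ x, φ x ≤ 1) (hw : w ⬝ᵥ w = 1) {u : Fin d → ℝ} (hu : u ⬝ᵥ u = 1) {t : ℝ}
    (ht : 0 ≤ t) :
    ∫ z, |tokenScore φ q w (z + t • u) - tokenScore φ q w z| ∂(gaussianPi d) ≤ 4 * t := by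
  have habs : Integrable (fun z : Fin d → ℝ => |z ⬝ᵥ w|) (gaussianPi d) :=
    ((memLp_dotProduct hw).integrable one_le_two).abs
  have hint : Integrable (fun z => |tokenScore φ q w (z + t • u) - tokenScore φ q w z|)
      (gaussianPi d) :=
    (((memLp_tokenScore_add hφ h0 h1 hw _).sub (memLp_tokenScore hφ h0 h1 hw)).integrable
      one_le_two).abs
  have ha : |(t • u) ⬝ᵥ w| ≤ t := by
    rw [smul_dotProduct, smul_eq_mul, abs_mul, abs_of_nonneg ht]
    exact mul_le_of_le_one_right ht (abs_dotProduct_le_one hu hw)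
  -- Short translations use the shift bound. For `t ≥ 1` the triangle inequality and `E|z ⬝ᵥ w| ≤ 1`
  -- already give `2 + t ≤ 4 * t`.
  rcases le_total t 1 with ht1 | ht1
  · obtain ⟨hi, hle⟩ := integral_abs_sub_mul_le (q := q) (H := fun x => |x|) (m := t • u)
      (a := 0) (b := t) hφ h0 h1 hw (by fun_prop) (fun x => abs_nonneg x)
      (memLp_id_gaussianReal' 2 (by simp)).abs le_rfl fun x => by
        have := abs_abs_sub_abs_le (x + (t • u) ⬝ᵥ w) x
        rw [add_sub_cancel_left] at this
        linarith
    have hmm : (t • u) ⬝ᵥ (t • u) = t ^ 2 := by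
      rw [smul_dotProduct, dotProduct_smul, hu]; simp [sq]
    simp only [sq_abs, integral_sq_gaussianReal, Real.sqrt_one, hmm] at hle
    have h3 := sqrt_exp_sq_sub_one_le ht ht1
    refine (integral_mono hint (hi.add (integrable_const t)) fun z => ?_).trans ?_
    · have e : tokenScore φ q w (z + t • u) - tokenScore φ q w z =
          (φ ((z + t • u) ⬝ᵥ q) - φ (z ⬝ᵥ q)) * (z ⬝ᵥ w)
            + φ ((z + t • u) ⬝ᵥ q) * ((t • u) ⬝ᵥ w) := by
        simp only [tokenScore, add_dotProduct]; ring
      simp only [Pi.add_apply]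
      rw [e]
      refine (abs_add_le _ _).trans (add_le_add (abs_mul _ _).le ?_)
      rw [abs_mul, abs_of_nonneg (h0 _)]
      exact (mul_le_of_le_one_left (abs_nonneg _) (h1 _)).trans ha
    · simp only [Pi.add_apply]
      rw [integral_add hi (integrable_const t)]
      simp only [integral_const, probReal_univ, one_smul]
      linarith
  · refine (integral_mono hint ((habs.const_mul 2).add (integrable_const t)) fun z => ?_).trans ?_
    · simp only [Pi.add_apply, tokenScore]
      refine (abs_sub _ _).trans ?_
      rw [abs_mul, abs_mul, abs_of_nonneg (h0 _), abs_of_nonneg (h0 _)]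
      have e1 := mul_le_of_le_one_left (abs_nonneg ((z + t • u) ⬝ᵥ w)) (h1 ((z + t • u) ⬝ᵥ q))
      have e2 := mul_le_of_le_one_left (abs_nonneg (z ⬝ᵥ w)) (h1 (z ⬝ᵥ q))
      have e3 := abs_add_le (z ⬝ᵥ w) ((t • u) ⬝ᵥ w)
      rw [← add_dotProduct] at e3
      linarith
    · simp only [Pi.add_apply]
      rw [integral_add (habs.const_mul 2) (integrable_const t), integral_const_mul]
      simp only [integral_const, probReal_univ, one_smul]
      linarith [integral_abs_dotProduct_le hw]

/-- The increment `x` of `φ` satisfies `|x| ≤ 1`, hence `x ^ 2 ≤ |x|`, and the first-order bound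
with `H = x ^ 2` applies. The resulting order `t`, rather than `t ^ 2`, suffices for Chebyshev. -/
theorem integral_tokenScore_add_sub_sq_le (hφ : Monotone φ) (h0 : ∀ x, 0 ≤ φ x)
    (h1 : ∀ x, φ x ≤ 1) (hw : w ⬝ᵥ w = 1) {u : Fin d → ℝ} (hu : u ⬝ᵥ u = 1) {t : ℝ}
    (ht : 0 ≤ t) (ht1 : t ≤ 1) :
    ∫ z, (tokenScore φ q w (z + t • u) - tokenScore φ q w z) ^ 2 ∂(gaussianPi d) ≤
      (8 + 4 * √(∫ x, (x ^ 2) ^ 2 ∂(gaussianReal 0 1))) * t := by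
  have hint : Integrable (fun z => (tokenScore φ q w (z + t • u) - tokenScore φ q w z) ^ 2)
      (gaussianPi d) :=
    ((memLp_tokenScore_add hφ h0 h1 hw _).sub (memLp_tokenScore hφ h0 h1 hw)).integrable_sq
  have ha : |(t • u) ⬝ᵥ w| ≤ t := by
    rw [smul_dotProduct, smul_eq_mul, abs_mul, abs_of_nonneg ht]
    exact mul_le_of_le_one_right ht (abs_dotProduct_le_one hu hw)
  have ha2 : ((t • u) ⬝ᵥ w) ^ 2 ≤ t ^ 2 := sq_le_sq.2 (by rwa [abs_of_nonneg ht])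
  obtain ⟨hi, hle⟩ := integral_abs_sub_mul_le (q := q) (H := fun x => x ^ 2) (m := t • u)
    (a := 2 * t) (b := t ^ 2) hφ h0 h1 hw (by fun_prop) (fun x => sq_nonneg x)
    memLp_sq_gaussianReal (by positivity) fun x => by
      have e : (x + (t • u) ⬝ᵥ w) ^ 2 - x ^ 2 = 2 * ((t • u) ⬝ᵥ w) * x + ((t • u) ⬝ᵥ w) ^ 2 := by
        ring
      rw [e]
      refine (abs_add_le _ _).trans (add_le_add ?_ (by rwa [abs_of_nonneg (sq_nonneg _)]))
      rw [abs_mul, abs_mul, abs_two]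
      gcongr
  have hmm : (t • u) ⬝ᵥ (t • u) = t ^ 2 := by
    rw [smul_dotProduct, dotProduct_smul, hu]; simp [sq]
  rw [hmm] at hle
  have h3 := mul_le_mul_of_nonneg_left (sqrt_exp_sq_sub_one_le ht ht1)
    (Real.sqrt_nonneg (∫ x, (x ^ 2) ^ 2 ∂(gaussianReal 0 1)))
  refine (integral_mono hint ((hi.const_mul 2).add (integrable_const (2 * t ^ 2)))
    fun z => ?_).trans ?_
  · have e : tokenScore φ q w (z + t • u) - tokenScore φ q w z =
        (φ ((z + t • u) ⬝ᵥ q) - φ (z ⬝ᵥ q)) * (z ⬝ᵥ w)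
          + φ ((z + t • u) ⬝ᵥ q) * ((t • u) ⬝ᵥ w) := by
      simp only [tokenScore, add_dotProduct]; ring
    simp only [Pi.add_apply]
    rw [e]
    set x := φ ((z + t • u) ⬝ᵥ q) - φ (z ⬝ᵥ q) with hx
    set p := φ ((z + t • u) ⬝ᵥ q) with hp
    have hx1 : |x| ≤ 1 := abs_le.2
      ⟨by linarith [h0 ((z + t • u) ⬝ᵥ q), h1 (z ⬝ᵥ q)],
        by linarith [h1 ((z + t • u) ⬝ᵥ q), h0 (z ⬝ᵥ q)]⟩
    have hx2 : x ^ 2 ≤ |x| := by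
      rw [← sq_abs]; nlinarith [abs_nonneg x]
    have hp2 : p ^ 2 ≤ 1 := by nlinarith [h0 ((z + t • u) ⬝ᵥ q), h1 ((z + t • u) ⬝ᵥ q)]
    have e1 : (x * (z ⬝ᵥ w)) ^ 2 ≤ |x| * (z ⬝ᵥ w) ^ 2 := by
      rw [mul_pow]; gcongr
    have e2 : (p * ((t • u) ⬝ᵥ w)) ^ 2 ≤ t ^ 2 := by
      rw [mul_pow]; exact (mul_le_of_le_one_left (sq_nonneg _) hp2).trans ha2
    linarith [add_sq_le (a := x * (z ⬝ᵥ w)) (b := p * ((t • u) ⬝ᵥ w))]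
  · simp only [Pi.add_apply]
    rw [integral_add (hi.const_mul 2) (integrable_const _), integral_const_mul]
    simp only [integral_const, probReal_univ, one_smul]
    nlinarith

theorem integral_tokenScore_add_sub_neg_sq_le (hφ : Monotone φ) (h0 : ∀ x, 0 ≤ φ x)
    (h1 : ∀ x, φ x ≤ 1) (hw : w ⬝ᵥ w = 1) {t : ℝ} (ht : 0 ≤ t) (ht1 : t ≤ 1) :
    ∫ z, (tokenScore φ q w (z + t • w) - tokenScore φ q w (z + t • -w)) ^ 2 ∂(gaussianPi d) ≤
      (32 + 16 * √(∫ x, (x ^ 2) ^ 2 ∂(gaussianReal 0 1))) * t := by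
  have hM := memLp_tokenScore (q := q) hφ h0 h1 hw
  have hP := memLp_tokenScore_add (q := q) hφ h0 h1 hw (t • w)
  have hN := memLp_tokenScore_add (q := q) hφ h0 h1 hw (t • -w)
  have i1 := (hP.sub hM).integrable_sq
  have i2 := (hN.sub hM).integrable_sq
  refine (integral_mono (hP.sub hN).integrable_sq ((i1.const_mul 2).add (i2.const_mul 2))
    fun z => ?_).trans ?_
  · simp only [Pi.add_apply, Pi.sub_apply]
    nlinarith [sq_nonneg (tokenScore φ q w (z + t • w) + tokenScore φ q w (z + t • -w)
      - 2 * tokenScore φ q w z)]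
  · simp only [Pi.add_apply]
    rw [integral_add (i1.const_mul 2) (i2.const_mul 2), integral_const_mul, integral_const_mul]
    have e1 := integral_tokenScore_add_sub_sq_le (q := q) hφ h0 h1 hw hw ht ht1
    have e2 := integral_tokenScore_add_sub_sq_le (q := q) hφ h0 h1 hw (u := -w)
      (by simpa using hw) ht ht1
    simp only [Pi.sub_apply]
    linarith

theorem measurePreserving_neg_gaussianPi (d : ℕ) :
    MeasurePreserving (fun z : Fin d → ℝ => -z) (gaussianPi d) (gaussianPi d) :=
  measurePreserving_pi (fun _ => gaussianReal 0 1) (fun _ => gaussianReal 0 1)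
    (f := fun _ x => -x) fun _ => ⟨by fun_prop, by simp [gaussianReal_map_neg]⟩

/-- Tokens with non-negative attention score keep a share `φ 0 / 2` of the second moment. -/
theorem le_integral_mul_sq (hφ : Monotone φ) (h0 : ∀ x, 0 ≤ φ x) (h1 : ∀ x, φ x ≤ 1)
    (hw : w ⬝ᵥ w = 1) :
    Integrable (fun z => φ (z ⬝ᵥ q) * (z ⬝ᵥ w) ^ 2) (gaussianPi d) ∧
      φ 0 / 2 ≤ ∫ z, φ (z ⬝ᵥ q) * (z ⬝ᵥ w) ^ 2 ∂(gaussianPi d) := by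
  have hφm := hφ.measurable
  have hsq := (memLp_dotProduct hw).integrable_sq
  have hm : Measurable fun z : Fin d → ℝ => φ (z ⬝ᵥ q) * (z ⬝ᵥ w) ^ 2 := by fun_prop
  have hi : Integrable (fun z => φ (z ⬝ᵥ q) * (z ⬝ᵥ w) ^ 2) (gaussianPi d) := by
    refine hsq.mono hm.aestronglyMeasurable (.of_forall fun z => ?_)
    rw [Real.norm_of_nonneg (mul_nonneg (h0 _) (sq_nonneg _)), Real.norm_of_nonneg (sq_nonneg _)]
    exact mul_le_of_le_one_left (sq_nonneg _) (h1 _)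
  refine ⟨hi, ?_⟩
  have hneg := measurePreserving_neg_gaussianPi d
  have hi' := hneg.integrable_comp_of_integrable hi
  have e : ∫ z, φ (-z ⬝ᵥ q) * (-z ⬝ᵥ w) ^ 2 ∂(gaussianPi d) =
      ∫ z, φ (z ⬝ᵥ q) * (z ⬝ᵥ w) ^ 2 ∂(gaussianPi d) := by
    rw [← integral_map (φ := fun z : Fin d → ℝ => -z)
      (f := fun z => φ (z ⬝ᵥ q) * (z ⬝ᵥ w) ^ 2) (by fun_prop) hm.aestronglyMeasurable,
      hneg.map_eq]
  -- One of `z` and `-z` has non-negative attention score, so the two weights add up to at least `φ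
  -- 0`.
  have h2 := integral_mono (hsq.const_mul (φ 0)) (hi.add hi') fun z => by
    simp only [Pi.add_apply, Function.comp, neg_dotProduct, neg_sq]
    rw [← add_mul]
    refine mul_le_mul_of_nonneg_right ?_ (sq_nonneg _)
    rcases le_total 0 (z ⬝ᵥ q) with h | h
    · linarith [hφ h, h0 (-(z ⬝ᵥ q))]
    · linarith [hφ (neg_nonneg.2 h), h0 (z ⬝ᵥ q)]
  simp only [Pi.add_apply] at h2
  rw [integral_add hi hi', integral_const_mul, integral_sq_dotProduct hw] at h2
  simp only [Function.comp_def, e] at h2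
  linarith

/-- Opposite translations separate the mean score at a linear rate. Moving both onto the density
gives `φ` times `h * sinh (t * h)`, up to a factor at least one; this dominates `t * h ^ 2`. -/
theorem le_integral_tokenScore_add_sub_neg (hφ : Monotone φ) (h0 : ∀ x, 0 ≤ φ x)
    (h1 : ∀ x, φ x ≤ 1) (hw : w ⬝ᵥ w = 1) {t : ℝ} (ht : 0 ≤ t) (ht1 : t ≤ 1) :
    φ 0 / 2 * t ≤
      ∫ z, (tokenScore φ q w (z + t • w) - tokenScore φ q w (z + t • -w)) ∂(gaussianPi d) := by
  have hcm := isCameronMartin_gaussianPi d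
  have hm := measurable_tokenScore (q := q) (w := w) hφ
  have hP := (memLp_tokenScore_add (q := q) hφ h0 h1 hw (t • w)).integrable one_le_two
  have hN := (memLp_tokenScore_add (q := q) hφ h0 h1 hw (t • -w)).integrable one_le_two
  rw [integral_sub hP hN, hcm.integral_add _ hm, hcm.integral_add _ hm, ← integral_sub
    ((hcm.integrable_add_iff _ hm).1 hP) ((hcm.integrable_add_iff _ hm).1 hN)]
  obtain ⟨hi, hle⟩ := le_integral_mul_sq (q := q) hφ h0 h1 hw
  refine le_trans ?_ (integral_mono (hi.const_mul t)
    (((hcm.integrable_add_iff _ hm).1 hP).sub ((hcm.integrable_add_iff _ hm).1 hN)) fun z => ?_)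
  · rw [integral_const_mul]
    nlinarith
  · simp only [smul_dotProduct, dotProduct_smul, neg_dotProduct, dotProduct_neg, hw,
      smul_eq_mul, dotProduct_comm w z, tokenScore, mul_neg, neg_neg, mul_one]
    set h := z ⬝ᵥ w
    have e1 : Real.exp (t * h - t * t / 2) * (φ (z ⬝ᵥ q) * h)
        - Real.exp (-(t * h) - t * t / 2) * (φ (z ⬝ᵥ q) * h) =
        φ (z ⬝ᵥ q) * (2 * Real.exp (-(t * t / 2)) * (h * Real.sinh (t * h))) := by
      rw [Real.sinh_eq, sub_eq_add_neg (t * h), sub_eq_add_neg (-(t * h)), Real.exp_add,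
        Real.exp_add]
      ring
    rw [e1, mul_left_comm]
    refine mul_le_mul_of_nonneg_left ?_ (h0 _)
    have e2 : t * h ^ 2 ≤ h * Real.sinh (t * h) := by
      rcases le_total 0 h with hh | hh
      · have := Real.self_le_sinh_iff.2 (mul_nonneg ht hh)
        nlinarith
      · have := Real.sinh_le_self_iff.2 (mul_nonpos_of_nonneg_of_nonpos ht hh)
        nlinarith
    have e3 : 1 ≤ 2 * Real.exp (-(t * t / 2)) := by
      have := Real.add_one_le_exp (-(t * t / 2))
      nlinarith
    have e4 : 0 ≤ t * h ^ 2 := by positivity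
    nlinarith

end TokenScore

/-! ### The score of a pure noise matrix: concentration and anti-concentration. -/

variable {L : ℕ}

instance (L d : ℕ) : IsProbabilityMeasure (noiseLaw L d) := by
  unfold noiseLaw
  infer_instance

/-- The output of the approximate attention model before adding the bias. -/
def score (φ : ℝ → ℝ) (q w : Fin d → ℝ) (X : Tokens L d) : ℝ := ∑ k, tokenScore φ q w (X k)

theorem measurePreserving_eval_noiseLaw (k : Fin L) :
    MeasurePreserving (Function.eval k) (noiseLaw L d) (gaussianPi d) :=
  measurePreserving_eval (fun _ : Fin L => gaussianPi d) k

theorem integrable_comp_eval_noiseLaw (k : Fin L) {f : (Fin d → ℝ) → ℝ}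
    (hf : Integrable f (gaussianPi d)) : Integrable (fun X => f (X k)) (noiseLaw L d) :=
  (measurePreserving_eval_noiseLaw k).integrable_comp_of_integrable hf

theorem integral_comp_eval_noiseLaw (k : Fin L) {f : (Fin d → ℝ) → ℝ}
    (hf : Integrable f (gaussianPi d)) :
    ∫ X, f (X k) ∂(noiseLaw L d) = ∫ z, f z ∂(gaussianPi d) :=
  integral_comp_eval (μ := fun _ : Fin L => gaussianPi d) (i := k) hf.aestronglyMeasurable

theorem isCameronMartin_noiseLaw (L d : ℕ) :
    IsCameronMartin (noiseLaw L d) fun X Y => ∑ k, X k ⬝ᵥ Y k :=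
  (isCameronMartin_gaussianPi d).pi (Fin L)

/-- A sum of independent copies of `D` exceeds half its mean up to the Chebyshev error. -/
theorem noiseLaw_sum_le_le {D : (Fin d → ℝ) → ℝ} (hD : MemLp D 2 (gaussianPi d)) {κ v : ℝ}
    (hκ : 0 < κ) (hmean : 2 * κ ≤ L * ∫ z, D z ∂(gaussianPi d))
    (hv : ∫ z, D z ^ 2 ∂(gaussianPi d) ≤ v) :
    (noiseLaw L d).real {X | ∑ k, D (X k) ≤ κ} ≤ L * v / κ ^ 2 := by
  have hS : MemLp (fun X : Tokens L d => ∑ k, D (X k)) 2 (noiseLaw L d) :=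
    memLp_finsetSum _ fun k _ => hD.comp_measurePreserving (measurePreserving_eval_noiseLaw k)
  have hE : ∫ X : Tokens L d, ∑ k, D (X k) ∂(noiseLaw L d) = L * ∫ z, D z ∂(gaussianPi d) := by
    have hi := hD.integrable one_le_two
    rw [integral_finsetSum _ fun k _ => integrable_comp_eval_noiseLaw k hi]
    simp [integral_comp_eval_noiseLaw _ hi]
  have hV : Var[fun X : Tokens L d => ∑ k, D (X k); noiseLaw L d] ≤ L * v := by
    have h1 := variance_sum_pi (μ := fun _ : Fin L => gaussianPi d) fun _ => hD
    have h2 : (∑ k, fun X : Tokens L d => D (X k)) = fun X => ∑ k, D (X k) := by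
      ext X; simp
    rw [h2] at h1
    refine h1.le.trans ?_
    have h3 : Var[D; gaussianPi d] ≤ v :=
      (variance_le_expectation_sq hD.aestronglyMeasurable).trans hv
    simpa using mul_le_mul_of_nonneg_left h3 (Nat.cast_nonneg L)
  have hc := meas_ge_le_variance_div_sq hS hκ
  have hsub : {X : Tokens L d | ∑ k, D (X k) ≤ κ} ⊆
      {X | κ ≤ |∑ k, D (X k) - ∫ X : Tokens L d, ∑ k, D (X k) ∂(noiseLaw L d)|} := by
    intro X hX
    simp only [Set.mem_ofPred_eq] at hX ⊢
    rw [hE, le_abs]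
    right
    linarith
  refine (ENNReal.toReal_le_of_le_ofReal ?_ ((measure_mono hsub).trans hc)).trans ?_
  · exact div_nonneg (variance_nonneg _ _) (sq_nonneg _)
  · exact div_le_div_of_nonneg_right hV (sq_nonneg _)

/-- A constant for the mean square fluctuation of a token's score under translations. -/
noncomputable def fluctuationConst : ℝ := 32 + 16 * √(∫ x, (x ^ 2) ^ 2 ∂(gaussianReal 0 1))

theorem fluctuationConst_nonneg : 0 ≤ fluctuationConst := by
  unfold fluctuationConst
  positivity

variable {φ : ℝ → ℝ} {q w : Fin d → ℝ}

theorem measurable_score (hφ : Monotone φ) : Measurable (score (L := L) φ q w) := by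
  have := measurable_tokenScore (q := q) (w := w) hφ
  exact Finset.measurable_sum _ fun k _ => this.comp (measurable_pi_apply k)

/-- Anti-concentration of the score of pure noise, at the scale `√L`. -/
theorem noiseLaw_score_sub_le (hφ : Monotone φ) (h0 : ∀ x, 0 ≤ φ x) (h1 : ∀ x, φ x ≤ 1)
    (hφ0 : 0 < φ 0) (hw : w ⬝ᵥ w = 1) (hL : 0 < L) {ε : ℝ} (hε : 0 < ε) (hε1 : ε ≤ 1) (t : ℝ) :
    (noiseLaw L d).real {X | t < score φ q w X} -
      (noiseLaw L d).real {X | t + φ 0 * ε * √L / 4 < score φ q w X} ≤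
      4 * ε + 16 * fluctuationConst / (φ 0 ^ 2 * (ε * √L)) := by
  have hL' : (1 : ℝ) ≤ L := by exact_mod_cast hL
  have hs : 1 ≤ √(L : ℝ) := Real.one_le_sqrt.2 hL'
  have hs0 : 0 < √(L : ℝ) := by linarith
  have hss : √(L : ℝ) * √(L : ℝ) = L := Real.mul_self_sqrt (by linarith)
  generalize √(L : ℝ) = s at *
  -- Chosen so that `L * δ ^ 2 = ε ^ 2`: shifting all tokens by `δ` costs total variation at most `2
  -- * ε`.
  set δ : ℝ := ε / s with hδ
  have hδ0 : 0 < δ := by positivity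
  have hδ1 : δ ≤ 1 := (div_le_one hs0).2 (hε1.trans hs)
  -- Half of the lower bound `L * (φ 0 / 2 * δ)` for the mean separation of the two shifted scores,
  -- as Chebyshev requires.
  set κ : ℝ := φ 0 * ε * s / 4 with hκ
  have hκ0 : 0 < κ := by positivity
  have hcm := isCameronMartin_noiseLaw L d
  have hm := measurable_score (L := L) (q := q) (w := w) hφ
  have hTV : ∀ u : Fin d → ℝ, u ⬝ᵥ u = 1 → ∀ r : ℝ,
      |(noiseLaw L d).real {X | r < score φ q w (X + fun _ => δ • u)} -
        (noiseLaw L d).real {X | r < score φ q w X}| ≤ 2 * ε := by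
    intro u hu r
    have h := hcm.abs_measureReal_preimage_sub_le (fun _ => δ • u)
      (measurableSet_lt (measurable_const (a := r)) hm)
    have e : ∑ _k : Fin L, (δ • u) ⬝ᵥ (δ • u) = ε ^ 2 := by
      simp only [smul_dotProduct, dotProduct_smul, hu, smul_eq_mul, Finset.sum_const,
        Finset.card_univ, Fintype.card_fin, nsmul_eq_mul, mul_one, hδ]
      rw [← hss]
      field_simp
    rw [e] at h
    exact h.trans (sqrt_exp_sq_sub_one_le hε.le hε1)
  have hp := abs_le.1 (hTV w hw (t + κ))
  have hn := abs_le.1 (hTV (-w) (by simpa using hw) t)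
  have hD := (memLp_tokenScore_add (q := q) hφ h0 h1 hw (δ • w)).sub
    (memLp_tokenScore_add (q := q) hφ h0 h1 hw (δ • -w))
  have hbad := noiseLaw_sum_le_le (L := L) hD hκ0 (by
    have := mul_le_mul_of_nonneg_left
      (le_integral_tokenScore_add_sub_neg (q := q) hφ h0 h1 hw hδ0.le hδ1) (Nat.cast_nonneg (α := ℝ) L)
    refine le_trans (le_of_eq ?_) this
    rw [hκ, hδ, ← hss]
    field_simp
    ring) (integral_tokenScore_add_sub_neg_sq_le (q := q) hφ h0 h1 hw hδ0.le hδ1)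
  have hconst : (L : ℝ) * ((32 + 16 * √(∫ x, (x ^ 2) ^ 2 ∂(gaussianReal 0 1))) * δ) / κ ^ 2 =
      16 * fluctuationConst / (φ 0 ^ 2 * (ε * s)) := by
    rw [fluctuationConst, hκ, hδ, ← hss]
    field_simp
    ring
  rw [hconst] at hbad
  -- Unless the separation fails, a score above `t` after the shift by `-δ` is above `t + κ` after
  -- the shift by `δ`. Undoing each shift costs `2 * ε`.
  have hsub : {X : Tokens L d | t < score φ q w (X + fun _ => δ • -w)} ⊆
      {X | t + κ < score φ q w (X + fun _ => δ • w)} ∪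
      {X | ∑ k, ((fun z => tokenScore φ q w (z + δ • w)) -
        fun z => tokenScore φ q w (z + δ • -w)) (X k) ≤ κ} := by
    intro X hX
    simp only [Set.mem_union, Set.mem_ofPred_eq, Pi.sub_apply, Finset.sum_sub_distrib, score,
      Pi.add_apply] at hX ⊢
    by_contra! hcon
    linarith [hcon.1, hcon.2]
  have hu := (measureReal_mono (μ := noiseLaw L d) hsub).trans (measureReal_union_le _ _)
  linarith [hp.2, hn.1]

/-! ### The effect of a weak signal on the law of the score. -/

/-- The tokens `θ v ξᵀ`, where `v` indicates `S`. -/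
def signal (θ : ℝ) (u : Fin d → ℝ) (S : Finset (Fin L)) : Tokens L d :=
  fun k => if k ∈ S then θ • u else 0

theorem integral_abs_score_add_signal_sub_le (hφ : Monotone φ) (h0 : ∀ x, 0 ≤ φ x)
    (h1 : ∀ x, φ x ≤ 1) (hw : w ⬝ᵥ w = 1) {u : Fin d → ℝ} (hu : u ⬝ᵥ u = 1) {θ : ℝ}
    (hθ : 0 ≤ θ) (S : Finset (Fin L)) :
    Integrable (fun X => |score φ q w (X + signal θ u S) - score φ q w X|) (noiseLaw L d) ∧
    ∫ X, |score φ q w (X + signal θ u S) - score φ q w X| ∂(noiseLaw L d) ≤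
      4 * (θ * S.card) := by
  have hi : ∀ m : Fin d → ℝ,
      Integrable (fun z => tokenScore φ q w (z + m) - tokenScore φ q w z) (gaussianPi d) :=
    fun m => ((memLp_tokenScore_add hφ h0 h1 hw m).sub
      (memLp_tokenScore hφ h0 h1 hw)).integrable one_le_two
  have e : ∀ X : Tokens L d, score φ q w (X + signal θ u S) - score φ q w X =
      ∑ k ∈ S, (tokenScore φ q w (X k + θ • u) - tokenScore φ q w (X k)) := by
    intro X
    rw [score, score, ← Finset.sum_sub_distrib, ← Finset.sum_subset (Finset.subset_univ S)]
    · exact Finset.sum_congr rfl fun k hk => by simp [signal, hk]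
    · intro k _ hk
      simp [signal, hk]
  simp_rw [e]
  have hk : ∀ k : Fin L, Integrable (fun X : Tokens L d =>
      |tokenScore φ q w (X k + θ • u) - tokenScore φ q w (X k)|) (noiseLaw L d) := fun k =>
    integrable_comp_eval_noiseLaw k (hi (θ • u)).abs
  have hsum : Integrable (fun X : Tokens L d => |∑ k ∈ S,
      (tokenScore φ q w (X k + θ • u) - tokenScore φ q w (X k))|) (noiseLaw L d) :=
    (integrable_finsetSum S fun k _ => integrable_comp_eval_noiseLaw k (hi (θ • u))).abs
  refine ⟨hsum, ?_⟩
  refine (integral_mono hsum (integrable_finsetSum S fun k _ => hk k)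
    fun X => Finset.abs_sum_le_sum_abs _ _).trans ?_
  rw [integral_finsetSum _ fun k _ => hk k]
  refine (Finset.sum_le_card_nsmul S _ (4 * θ) fun k _ => ?_).trans (le_of_eq ?_)
  · rw [integral_comp_eval_noiseLaw k (hi (θ • u)).abs]
    exact integral_abs_tokenScore_add_sub_le hφ h0 h1 hw hu hθ
  · rw [nsmul_eq_mul]; ring

/-- A weak signal barely changes the law of the score. -/
theorem noiseLaw_score_le_sub_le_of_unit (hφ : Monotone φ) (h0 : ∀ x, 0 ≤ φ x) (h1 : ∀ x, φ x ≤ 1)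
    (hφ0 : 0 < φ 0) (hw : w ⬝ᵥ w = 1) {u : Fin d → ℝ} (hu : u ⬝ᵥ u = 1) {θ : ℝ}
    (hθ : 0 ≤ θ) (S : Finset (Fin L)) (hL : 0 < L) {ε : ℝ} (hε : 0 < ε) (hε1 : ε ≤ 1) (t : ℝ) :
    (noiseLaw L d).real {X | score φ q w X ≤ t} -
      (noiseLaw L d).real {X | score φ q w (X + signal θ u S) ≤ t} ≤
      4 * ε + 16 * fluctuationConst / (φ 0 ^ 2 * (ε * √L)) +
        16 * (θ * S.card / √L) / (φ 0 * ε) := by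
  have hs0 : 0 < √(L : ℝ) := Real.sqrt_pos.2 (by exact_mod_cast hL)
  set κ : ℝ := φ 0 * ε * √L / 4 with hκ
  have hκ0 : 0 < κ := by positivity
  have hm := measurable_score (L := L) (q := q) (w := w) hφ
  -- The window `(t - κ, t]` has small mass, and by Markov the signal moves the score by less than
  -- `κ` with high probability.
  have hanti := noiseLaw_score_sub_le (q := q) hφ h0 h1 hφ0 hw hL hε hε1 (t - κ)
  rw [← hκ, sub_add_cancel] at hanti
  obtain ⟨hi, hle⟩ :=
    integral_abs_score_add_signal_sub_le (L := L) (q := q) hφ h0 h1 hw hu hθ S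
  have hmarkov := (mul_meas_ge_le_integral_of_nonneg
    (.of_forall fun X => abs_nonneg _) hi κ).trans hle
  set P := (noiseLaw L d).real {X | κ ≤ |score φ q w (X + signal θ u S) - score φ q w X|}
  have hP : P ≤ 16 * (θ * S.card / √L) / (φ 0 * ε) := by
    have h2 : P ≤ 4 * (θ * S.card) / κ := (le_div_iff₀' hκ0).2 hmarkov
    refine h2.trans (le_of_eq ?_)
    rw [hκ]
    field_simp
    ring
  have hcompl : ∀ s : ℝ, (noiseLaw L d).real {X | score φ q w X ≤ s} =
      1 - (noiseLaw L d).real {X | s < score φ q w X} := by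
    intro s
    rw [← probReal_compl_eq_one_sub (measurableSet_lt measurable_const hm)]
    congr 1
    ext X
    simp
  have hsub : {X : Tokens L d | score φ q w X ≤ t - κ} ⊆
      {X | score φ q w (X + signal θ u S) ≤ t} ∪
      {X | κ ≤ |score φ q w (X + signal θ u S) - score φ q w X|} := by
    intro X hX
    simp only [Set.mem_union, Set.mem_ofPred_eq] at hX ⊢
    by_contra! hcon
    linarith [hcon.1, hcon.2, le_abs_self (score φ q w (X + signal θ u S) - score φ q w X)]
  have hu := (measureReal_mono (μ := noiseLaw L d) hsub).trans (measureReal_union_le _ _)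
  linarith [hcompl t, hcompl (t - κ)]

theorem score_smul (c : ℝ) (X : Tokens L d) : score φ q (c • w) X = c * score φ q w X := by
  simp only [score, tokenScore, dotProduct_smul, smul_eq_mul, Finset.mul_sum]
  exact Finset.sum_congr rfl fun k _ => by ring

/-- The score is linear in `w`, so normalising `w` only rescales the threshold. For `w = 0` both
scores vanish and the probabilities agree. -/
theorem noiseLaw_score_le_sub_le (hφ : Monotone φ) (h0 : ∀ x, 0 ≤ φ x) (h1 : ∀ x, φ x ≤ 1)
    (hφ0 : 0 < φ 0) (w : Fin d → ℝ) {u : Fin d → ℝ} (hu : u ⬝ᵥ u = 1) {θ : ℝ}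
    (hθ : 0 ≤ θ) (S : Finset (Fin L)) (hL : 0 < L) {ε : ℝ} (hε : 0 < ε) (hε1 : ε ≤ 1) (t : ℝ) :
    (noiseLaw L d).real {X | score φ q w X ≤ t} -
      (noiseLaw L d).real {X | score φ q w (X + signal θ u S) ≤ t} ≤
      4 * ε + 16 * fluctuationConst / (φ 0 ^ 2 * (ε * √L)) +
        16 * (θ * S.card / √L) / (φ 0 * ε) := by
  rcases eq_or_ne w 0 with rfl | hw
  · have hC := fluctuationConst_nonneg
    simp only [score, tokenScore, dotProduct_zero, mul_zero, Finset.sum_const_zero, sub_self]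
    positivity
  · have hww : 0 < w ⬝ᵥ w :=
      lt_of_le_of_ne (Finset.sum_nonneg fun i _ => mul_self_nonneg _)
        fun h => hw (dotProduct_self_eq_zero.1 h.symm)
    set c := √(w ⬝ᵥ w) with hc
    have hc0 : 0 < c := Real.sqrt_pos.2 hww
    have hcc : c * c = w ⬝ᵥ w := Real.mul_self_sqrt hww.le
    have hunit : (c⁻¹ • w) ⬝ᵥ (c⁻¹ • w) = 1 := by
      rw [smul_dotProduct, dotProduct_smul, ← hcc]
      simp only [smul_eq_mul]
      field_simp
    have h := noiseLaw_score_le_sub_le_of_unit (q := q) hφ h0 h1 hφ0 hunit hu hθ S hL hε hε1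
      (c⁻¹ * t)
    simpa only [score_smul, mul_le_mul_iff_right₀ (inv_pos.2 hc0)] using h

/-! ### From scores to test errors: bounds at fixed `L`. -/

theorem approxAttention_eq_sign_score (q w : Fin d → ℝ) (b : ℝ) (X : Tokens L d) :
    approxAttention φ (q, w, b) X = Real.sign (score φ q w X + b) := by
  have h : approxFeature φ q X ⬝ᵥ w = score φ q w X := by
    simp only [approxFeature, score, tokenScore, dotProduct, Matrix.mulVec, Matrix.transpose_apply,
      Matrix.of_apply, Finset.sum_mul, Finset.mul_sum]
    rw [Finset.sum_comm]
    refine Finset.sum_congr rfl fun k _ => Finset.sum_congr rfl fun j _ => ?_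
    ring
  rw [approxAttention, h]

/-- Since `Real.sign 0 = 0` is neither label, a score on the boundary is an error for both labels;
hence the non-strict inequality. -/
theorem sign_ne_one_iff (x : ℝ) : Real.sign x ≠ 1 ↔ x ≤ 0 := by
  rcases lt_trichotomy x 0 with h | rfl | h
  · rw [Real.sign_of_neg h]; constructor <;> intro _ <;> [exact h.le; norm_num]
  · simp
  · simp [Real.sign_of_pos h, h]

theorem sign_ne_neg_one_iff (x : ℝ) : Real.sign x ≠ -1 ↔ 0 ≤ x := by
  rcases lt_trichotomy x 0 with h | rfl | h
  · simp [Real.sign_of_neg h, h]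
  · simp
  · rw [Real.sign_of_pos h]; constructor <;> intro _ <;> [exact h.le; norm_num]

theorem measurable_approxAttention (hφ : Monotone φ)
    (W : (Fin d → ℝ) × (Fin d → ℝ) × ℝ) : Measurable (approxAttention (L := L) φ W) := by
  obtain ⟨q, w, b⟩ := W
  have hsign : Measurable Real.sign := by
    unfold Real.sign
    exact Measurable.ite measurableSet_Iio measurable_const
      (Measurable.ite measurableSet_Ioi measurable_const measurable_const)
  have h : approxAttention (L := L) φ (q, w, b) = fun X => Real.sign (score φ q w X + b) := by
    ext X
    exact approxAttention_eq_sign_score q w b X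
  rw [h]
  exact hsign.comp ((measurable_score hφ).add_const b)

/-- Conditioning on the label and on the informative set leaves only the noise law and its
translates. -/
theorem testError_sampleLaw {prob θ : ℝ} (hprob : prob ∈ Set.Ioo (0 : ℝ) 1)
    (ξ : EuclideanSpace ℝ (Fin d)) (ν : PMF (Finset (Fin L))) {yhat : Tokens L d → ℝ}
    (hy : Measurable yhat) :
    testError (sampleLaw prob θ ξ ν) yhat =
      (1 - prob) * (noiseLaw L d).real {X | yhat X ≠ -1} +
        prob * ∑ S, (ν S).toReal *
          (noiseLaw L d).real {X | yhat (X + signal θ ξ.ofLp S) ≠ 1} := by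
  have hA : MeasurableSet {s : Tokens L d × ℝ | yhat s.1 ≠ s.2} :=
    (measurableSet_eq_fun (hy.comp measurable_fst) measurable_snd).compl
  have hsig : ∀ (S : Finset (Fin L)) (Z : Tokens L d),
      θ • Matrix.of.symm (Matrix.vecMulVec (indicatorVec S) ξ.ofLp) + Z =
        Z + signal θ ξ.ofLp S := by
    intro S Z
    ext k j
    by_cases hk : k ∈ S <;>
      simp [signal, indicatorVec, Matrix.vecMulVec_apply, hk, add_comm]
  have hm : ∀ S : Finset (Fin L),
      Measurable fun Z : Tokens L d => (Z + signal θ ξ.ofLp S, (1 : ℝ)) := fun S =>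
    (measurable_add_const _).prodMk measurable_const
  have e1 : sampleLaw prob θ ξ ν {s | yhat s.1 ≠ s.2} =
      ENNReal.ofReal (1 - prob) * noiseLaw L d {X | yhat X ≠ -1} +
        ENNReal.ofReal prob * ∑ S, ν S * noiseLaw L d {X | yhat (X + signal θ ξ.ofLp S) ≠ 1} := by
    simp only [sampleLaw, hsig, Measure.add_apply, Measure.smul_apply, Measure.finsetSum_apply,
      smul_eq_mul]
    rw [Measure.map_apply (by fun_prop) hA]
    congr 2
    refine Finset.sum_congr rfl fun S _ => ?_
    rw [Measure.map_apply (hm S) hA]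
    rfl
  have hfin : ∀ S, ν S * noiseLaw L d {X | yhat (X + signal θ ξ.ofLp S) ≠ 1} ≠ ⊤ := fun S =>
    ENNReal.mul_ne_top (ν.apply_ne_top S) (measure_ne_top _ _)
  rw [testError, measureReal_def, e1, ENNReal.toReal_add
    (ENNReal.mul_ne_top ENNReal.ofReal_ne_top (measure_ne_top _ _))
    (ENNReal.mul_ne_top ENNReal.ofReal_ne_top (ENNReal.sum_ne_top.2 fun S _ => hfin S)),
    ENNReal.toReal_mul, ENNReal.toReal_mul, ENNReal.toReal_ofReal (sub_nonneg.2 hprob.2.le),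
    ENNReal.toReal_ofReal hprob.1.le, ENNReal.toReal_sum fun S _ => hfin S]
  simp only [ENNReal.toReal_mul, measureReal_def]

theorem sum_toReal_pmf {α : Type*} [Fintype α] (ν : PMF α) : ∑ a, (ν a).toReal = 1 := by
  rw [← ENNReal.toReal_sum fun a _ => ν.apply_ne_top a, ← tsum_fintype (L := .unconditional α),
    ν.tsum_coe, ENNReal.toReal_one]

theorem approxAttentionError_le_testError (prob θ : ℝ) (ξ : EuclideanSpace ℝ (Fin d))
    (ν : PMF (Finset (Fin L))) (W : (Fin d → ℝ) × (Fin d → ℝ) × ℝ) :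
    approxAttentionError φ prob θ ξ ν ≤ testError (sampleLaw prob θ ξ ν) (approxAttention φ W) :=
  ciInf_le ⟨0, by rintro _ ⟨W, rfl⟩; exact measureReal_nonneg⟩ W

theorem approxAttentionError_nonneg (prob θ : ℝ) (ξ : EuclideanSpace ℝ (Fin d))
    (ν : PMF (Finset (Fin L))) : 0 ≤ approxAttentionError φ prob θ ξ ν :=
  Real.iInf_nonneg fun _ => measureReal_nonneg

/-- Constant predictors achieve the error of the less frequent label. -/
theorem approxAttentionError_le_min (hφ : Monotone φ) {prob θ : ℝ}
    (hprob : prob ∈ Set.Ioo (0 : ℝ) 1) (ξ : EuclideanSpace ℝ (Fin d))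
    (ν : PMF (Finset (Fin L))) :
    approxAttentionError φ prob θ ξ ν ≤ min prob (1 - prob) := by
  have hs : ∀ (b : ℝ) (X : Tokens L d), approxAttention φ (0, 0, b) X = Real.sign b := by
    intro b X
    rw [approxAttention_eq_sign_score]
    simp [score, tokenScore]
  refine le_min ?_ ?_
  · refine (approxAttentionError_le_testError _ _ _ _ (0, 0, -1)).trans (le_of_eq ?_)
    rw [testError_sampleLaw hprob ξ ν (measurable_approxAttention hφ _)]
    have h1 : (-1 : ℝ) ≠ 1 := by norm_num
    simp [hs, Real.sign_neg, Real.sign_one, h1, sum_toReal_pmf]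
  · refine (approxAttentionError_le_testError _ _ _ _ (0, 0, 1)).trans (le_of_eq ?_)
    rw [testError_sampleLaw hprob ξ ν (measurable_approxAttention hφ _)]
    have h1 : (1 : ℝ) ≠ -1 := by norm_num
    simp [hs, Real.sign_one, h1]

theorem dotProduct_ofLp_self {ξ : EuclideanSpace ℝ (Fin d)} (hξ : ‖ξ‖ = 1) :
    ξ.ofLp ⬝ᵥ ξ.ofLp = 1 := by
  have h := EuclideanSpace.real_norm_sq_eq ξ
  rw [hξ] at h
  simp only [dotProduct, ← sq]
  linarith

/-- The optimal error is close to that of a constant predictor when `θ R ≪ √L`. -/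
theorem le_approxAttentionError (hφ : Monotone φ) (h0 : ∀ x, 0 ≤ φ x) (h1 : ∀ x, φ x ≤ 1)
    (hφ0 : 0 < φ 0) {prob θ : ℝ} (hprob : prob ∈ Set.Ioo (0 : ℝ) 1) (hθ : 0 ≤ θ)
    {ξ : EuclideanSpace ℝ (Fin d)} (hξ : ‖ξ‖ = 1) {ν : PMF (Finset (Fin L))} {R : ℕ}
    (hν : ∀ S ∈ ν.support, S.card = R) (hL : 0 < L) {ε : ℝ} (hε : 0 < ε) (hε1 : ε ≤ 1) :
    min prob (1 - prob) - (4 * ε + 16 * fluctuationConst / (φ 0 ^ 2 * (ε * √L)) +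
        16 * (θ * R / √L) / (φ 0 * ε)) ≤ approxAttentionError φ prob θ ξ ν := by
  have hC := fluctuationConst_nonneg
  set β := 4 * ε + 16 * fluctuationConst / (φ 0 ^ 2 * (ε * √L)) +
    16 * (θ * R / √L) / (φ 0 * ε) with hβ
  have hβ0 : 0 ≤ β := by positivity
  refine le_ciInf fun W => ?_
  rw [testError_sampleLaw hprob ξ ν (measurable_approxAttention hφ _)]
  obtain ⟨q, w, b⟩ := W
  have hm := measurable_score (L := L) (q := q) (w := w) hφ
  set p := (noiseLaw L d).real {X | score φ q w X ≤ -b} with hp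
  have hp0 : 0 ≤ p := measureReal_nonneg
  have hp1 : p ≤ 1 := measureReal_le_one
  have hneg : 1 - p ≤ (noiseLaw L d).real {X | approxAttention φ (q, w, b) X ≠ -1} := by
    rw [hp, ← probReal_compl_eq_one_sub (measurableSet_le hm measurable_const)]
    refine measureReal_mono fun X hX => ?_
    simp only [Set.mem_compl_iff, Set.mem_ofPred_eq, not_le] at hX ⊢
    rw [approxAttention_eq_sign_score, sign_ne_neg_one_iff]
    linarith
  have hpos : p - β ≤ ∑ S, (ν S).toReal *
      (noiseLaw L d).real {X | approxAttention φ (q, w, b) (X + signal θ ξ.ofLp S) ≠ 1} := by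
    have hsum : p - β = ∑ S, (ν S).toReal * (p - β) := by
      rw [← Finset.sum_mul, sum_toReal_pmf, one_mul]
    refine hsum.le.trans (Finset.sum_le_sum fun S _ => ?_)
    by_cases hS : S ∈ ν.support
    · refine mul_le_mul_of_nonneg_left ?_ ENNReal.toReal_nonneg
      have h := noiseLaw_score_le_sub_le (q := q) hφ h0 h1 hφ0 w (dotProduct_ofLp_self hξ) hθ S hL
        hε hε1 (-b)
      rw [hν S hS] at h
      have e : {X : Tokens L d | approxAttention φ (q, w, b) (X + signal θ ξ.ofLp S) ≠ 1} =
          {X | score φ q w (X + signal θ ξ.ofLp S) ≤ -b} := by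
        ext X
        simp only [Set.mem_ofPred_eq]
        rw [approxAttention_eq_sign_score, sign_ne_one_iff, le_neg_iff_add_nonpos_right]
      rw [e]
      linarith
    · rw [PMF.mem_support_iff, not_not] at hS
      simp [hS]
  -- If both classes fall below the threshold with probability `p`, the error is an average of `1 -
  -- prob` and `prob` with weights `1 - p` and `p`.
  have hmin : min prob (1 - prob) ≤ (1 - prob) * (1 - p) + prob * p := by
    have a1 := mul_le_mul_of_nonneg_right (min_le_right prob (1 - prob)) (sub_nonneg.2 hp1)
    have a2 := mul_le_mul_of_nonneg_right (min_le_left prob (1 - prob)) hp0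
    linarith
  have b1 := mul_le_mul_of_nonneg_left hneg (sub_nonneg.2 hprob.2.le)
  have b2 := mul_le_mul_of_nonneg_left hpos hprob.1.le
  have b3 := mul_le_of_le_one_left hβ0 hprob.2.le
  linarith

theorem noiseLaw_abs_sum_dotProduct_ge_le {u : Fin d → ℝ} (hu : u ⬝ᵥ u = 1) {a : ℝ} (ha : 0 < a) :
    (noiseLaw L d).real {X | a ≤ |∑ k, X k ⬝ᵥ u|} ≤ L / a ^ 2 := by
  have hD := memLp_dotProduct hu
  have hS : MemLp (fun X : Tokens L d => ∑ k, X k ⬝ᵥ u) 2 (noiseLaw L d) :=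
    memLp_finsetSum _ fun k _ => hD.comp_measurePreserving (measurePreserving_eval_noiseLaw k)
  have hz : ∫ z, z ⬝ᵥ u ∂(gaussianPi d) = 0 := by
    rw [integral_comp_dotProduct (H := fun x => x) hu measurable_id, integral_id_gaussianReal]
  have hE : ∫ X : Tokens L d, ∑ k, X k ⬝ᵥ u ∂(noiseLaw L d) = 0 := by
    have hi := hD.integrable one_le_two
    rw [integral_finsetSum _ fun k _ => integrable_comp_eval_noiseLaw k hi]
    simp [integral_comp_eval_noiseLaw _ hi, hz]
  have hV : Var[fun X : Tokens L d => ∑ k, X k ⬝ᵥ u; noiseLaw L d] = L := by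
    have h1 := variance_sum_pi (μ := fun _ : Fin L => gaussianPi d) fun _ => hD
    have h2 : (∑ k, fun X : Tokens L d => X k ⬝ᵥ u) = fun X => ∑ k, X k ⬝ᵥ u := by
      ext X; simp
    rw [h2] at h1
    rw [variance_of_integral_eq_zero (by fun_prop) hz, integral_sq_dotProduct hu] at h1
    exact h1.trans (by simp)
  have hc := meas_ge_le_variance_div_sq hS ha
  rw [hE, hV] at hc
  simp only [sub_zero] at hc
  exact ENNReal.toReal_le_of_le_ofReal (by positivity) hc

/-- Uniform attention in the signal direction achieves a small error when `θ R ≫ √L`. -/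
theorem approxAttentionError_le (hφ : Monotone φ) (hφ0 : 0 < φ 0) {prob θ : ℝ}
    (hprob : prob ∈ Set.Ioo (0 : ℝ) 1) {ξ : EuclideanSpace ℝ (Fin d)} (hξ : ‖ξ‖ = 1)
    {ν : PMF (Finset (Fin L))} {R : ℕ} (hν : ∀ S ∈ ν.support, S.card = R) (hθR : 0 < θ * R) :
    approxAttentionError φ prob θ ξ ν ≤ L / (θ * R / 2) ^ 2 := by
  set u := ξ.ofLp
  have hu : u ⬝ᵥ u = 1 := dotProduct_ofLp_self hξ
  set a := θ * R / 2 with ha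
  have ha0 : 0 < a := by positivity
  set P := (noiseLaw L d).real {X | a ≤ |∑ k, X k ⬝ᵥ u|}
  refine le_trans ?_ (noiseLaw_abs_sum_dotProduct_ge_le hu ha0)
  -- With `q = 0` every weight is `φ 0`; the bias sits midway between the class means `0` and `φ 0 *
  -- (2 * a)`, so any error forces a noise sum of size at least `a`.
  refine (approxAttentionError_le_testError _ _ _ _ (0, u, -(φ 0 * a))).trans ?_
  rw [testError_sampleLaw hprob ξ ν (measurable_approxAttention hφ _)]
  have hscore : ∀ X : Tokens L d, score φ 0 u X + -(φ 0 * a) = φ 0 * (∑ k, X k ⬝ᵥ u - a) := by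
    intro X
    simp only [score, tokenScore, dotProduct_zero, ← Finset.mul_sum]
    ring
  have hneg : (noiseLaw L d).real {X | approxAttention φ (0, u, -(φ 0 * a)) X ≠ -1} ≤ P := by
    refine measureReal_mono fun X hX => ?_
    simp only [Set.mem_ofPred_eq] at hX ⊢
    rw [approxAttention_eq_sign_score, sign_ne_neg_one_iff, hscore,
      mul_nonneg_iff_of_pos_left hφ0] at hX
    exact le_abs.2 (Or.inl (by linarith))
  have hpos : ∑ S, (ν S).toReal * (noiseLaw L d).real
      {X | approxAttention φ (0, u, -(φ 0 * a)) (X + signal θ u S) ≠ 1} ≤ P := by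
    have hsum : ∑ S, (ν S).toReal * P = P := by
      rw [← Finset.sum_mul, sum_toReal_pmf, one_mul]
    refine le_trans (Finset.sum_le_sum fun S _ => ?_) hsum.le
    by_cases hS : S ∈ ν.support
    · refine mul_le_mul_of_nonneg_left (measureReal_mono fun X hX => ?_) ENNReal.toReal_nonneg
      simp only [Set.mem_ofPred_eq] at hX ⊢
      have hsum : ∑ k, (X + signal θ u S) k ⬝ᵥ u = ∑ k, X k ⬝ᵥ u + 2 * a := by
        have e : ∑ k, signal θ u S k ⬝ᵥ u = θ * R := by
          have e1 : ∀ k, signal θ u S k ⬝ᵥ u = if k ∈ S then θ else 0 := by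
            intro k
            by_cases hk : k ∈ S <;> simp [signal, hk, hu]
          simp [e1, hν S hS, mul_comm]
        simp only [Pi.add_apply, add_dotProduct, Finset.sum_add_distrib]
        linarith
      rw [approxAttention_eq_sign_score, sign_ne_one_iff, hscore, hsum] at hX
      have := nonpos_of_mul_nonpos_right hX hφ0
      exact le_abs.2 (Or.inr (by linarith))
    · rw [PMF.mem_support_iff, not_not] at hS
      simp [hS]
  have b1 := mul_le_mul_of_nonneg_left hneg (sub_nonneg.2 hprob.2.le)
  have b2 := mul_le_mul_of_nonneg_left hpos hprob.1.le
  linarith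

/-! ### Limits as `L → ∞`. -/

section Limits

variable {prob : ℝ} {d : ℕ → ℕ} {ξ : ∀ L : ℕ, EuclideanSpace ℝ (Fin (d L))} {θ : ℕ → ℝ} {R : ℕ → ℕ}
  {ν : ∀ L : ℕ, PMF (Finset (Fin L))}

/-- For fixed `ε` the other error terms vanish, leaving `4 * ε`, which is arbitrary. A general
filter `l ≤ atTop` allows subsequences, as part (b) needs. -/
theorem tendsto_approxAttentionError_of_weak_signal (hφ : Monotone φ) (h0 : ∀ x, 0 ≤ φ x)
    (h1 : ∀ x, φ x ≤ 1) (hφ0 : 0 < φ 0) (hprob : prob ∈ Set.Ioo (0 : ℝ) 1) (hξ : ∀ L, ‖ξ L‖ = 1)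
    (hθ : ∀ L, 0 < θ L) {l : Filter ℕ} (hl : l ≤ atTop)
    (hν : ∀ᶠ L in l, ∀ S ∈ (ν L).support, S.card = R L)
    (hr : Tendsto (fun L : ℕ => θ L * (R L : ℝ) / √(L : ℝ)) l (𝓝 0)) :
    Tendsto (fun L : ℕ => approxAttentionError φ prob (θ L) (ξ L) (ν L)) l
      (𝓝 (min prob (1 - prob))) := by
  refine tendsto_order.2 ⟨fun a ha => ?_, fun a ha =>
    .of_forall fun L => (approxAttentionError_le_min hφ hprob _ _).trans_lt ha⟩
  obtain ⟨ε, hε, hε1, hεa⟩ : ∃ ε : ℝ, 0 < ε ∧ ε ≤ 1 ∧ 4 * ε < min prob (1 - prob) - a :=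
    ⟨min 1 ((min prob (1 - prob) - a) / 8), lt_min one_pos (by linarith), min_le_left _ _, by
      linarith [min_le_right 1 ((min prob (1 - prob) - a) / 8)]⟩
  have hsqrt : Tendsto (fun L : ℕ => √(L : ℝ)) l atTop :=
    (Real.tendsto_sqrt_atTop.comp tendsto_natCast_atTop_atTop).mono_left hl
  have t1 : Tendsto (fun L : ℕ => 16 * fluctuationConst / (φ 0 ^ 2 * (ε * √(L : ℝ)))) l (𝓝 0) :=
    ((hsqrt.const_mul_atTop hε).const_mul_atTop (by positivity)).const_div_atTop _
  have t2 : Tendsto (fun L : ℕ => 16 * (θ L * R L / √(L : ℝ)) / (φ 0 * ε)) l (𝓝 0) := by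
    simpa using (hr.const_mul 16).div_const (φ 0 * ε)
  have t3 := ((t1.const_add (4 * ε)).add t2).const_sub (min prob (1 - prob))
  filter_upwards [t3.eventually_const_lt (u := a) (by linarith), hν, hl (eventually_gt_atTop 0)]
    with L hL hcard hL0
  exact hL.trans_le
    (le_approxAttentionError hφ h0 h1 hφ0 hprob (hθ L).le (hξ L) hcard hL0 hε hε1)

theorem tendsto_approxAttentionError_of_strong_signal (hφ : Monotone φ) (hφ0 : 0 < φ 0)
    (hprob : prob ∈ Set.Ioo (0 : ℝ) 1) (hξ : ∀ L, ‖ξ L‖ = 1)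
    (hν : ∀ᶠ L in atTop, ∀ S ∈ (ν L).support, S.card = R L)
    (hr : Tendsto (fun L : ℕ => θ L * (R L : ℝ) / √(L : ℝ)) atTop atTop) :
    Tendsto (fun L : ℕ => approxAttentionError φ prob (θ L) (ξ L) (ν L)) atTop (𝓝 0) := by
  have hlim : Tendsto (fun L : ℕ => 4 / (θ L * (R L : ℝ) / √(L : ℝ)) ^ 2) atTop (𝓝 0) :=
    ((tendsto_pow_atTop two_ne_zero).comp hr).const_div_atTop 4
  refine squeeze_zero' (.of_forall fun L => approxAttentionError_nonneg _ _ _ _) ?_ hlim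
  filter_upwards [hν, hr.eventually_gt_atTop 0] with L hcard hpos
  have hθR : 0 < θ L * R L := by
    by_contra! h
    exact hpos.not_ge (div_nonpos_of_nonpos_of_nonneg h (Real.sqrt_nonneg _))
  refine (approxAttentionError_le hφ hφ0 hprob (hξ L) hcard hθR).trans (le_of_eq ?_)
  rw [div_pow, div_pow, Real.sq_sqrt (Nat.cast_nonneg L), div_div_eq_mul_div, div_div_eq_mul_div]
  ring

end Limits

end SparseToken

theorem proposition4
    (φ : ℝ → ℝ) (hφ_cont : Continuous φ) (hφ_mono : Monotone φ) (hφ_zero : 0 < φ 0)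
    (hφ_bot : Tendsto φ atBot (𝓝 0)) (hφ_top : Tendsto φ atTop (𝓝 1))
    (prob : ℝ) (hprob : prob ∈ Set.Ioo (0 : ℝ) 1)
    (d : ℕ → ℕ) (ξ : ∀ L : ℕ, EuclideanSpace ℝ (Fin (d L))) (hξ : ∀ L, ‖ξ L‖ = 1)
    (θ : ℕ → ℝ) (hθ : ∀ L, 0 < θ L)
    (R : ℕ → ℕ) (ν : ∀ L : ℕ, PMF (Finset (Fin L)))
    (hν_card : ∀ᶠ L in atTop, ∀ S ∈ (ν L).support, S.card = R L)
    (hν_spread : (fun L : ℕ => ‖SparseToken.marginals (ν L)‖) =O[atTop]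
      fun L : ℕ => (R L : ℝ) / √(L : ℝ)) :
    (∀ SNR : EReal,
      Tendsto (fun L : ℕ => ((θ L * (R L : ℝ) / √(L : ℝ) : ℝ) : EReal)) atTop (𝓝 SNR) →
        (SNR = ⊤ →
          Tendsto (fun L : ℕ => SparseToken.approxAttentionError φ prob (θ L) (ξ L) (ν L))
            atTop (𝓝 0)) ∧
        (SNR = 0 →
          Tendsto (fun L : ℕ => SparseToken.approxAttentionError φ prob (θ L) (ξ L) (ν L))
            atTop (𝓝 (min prob (1 - prob))))) ∧
    ((fun L : ℕ => (R L : ℝ)) =O[atTop] (fun _ : ℕ => (1 : ℝ)) →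
      Tendsto (fun L : ℕ => SparseToken.approxAttentionError φ prob (θ L) (ξ L) (ν L))
        atTop (𝓝 0) →
      (fun L : ℕ => √(L : ℝ)) =O[atTop] θ) := by
  have h0 : ∀ x, 0 ≤ φ x := fun x => hφ_mono.le_of_tendsto hφ_bot x
  have h1 : ∀ x, φ x ≤ 1 := fun x => hφ_mono.ge_of_tendsto hφ_top x
  refine ⟨fun SNR hSNR => ⟨?_, ?_⟩, fun hR hlim => ?_⟩
  · rintro rfl
    exact SparseToken.tendsto_approxAttentionError_of_strong_signal hφ_mono hφ_zero hprob hξ hν_card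
      (EReal.tendsto_coe_nhds_top_iff.1 hSNR)
  · rintro rfl
    exact SparseToken.tendsto_approxAttentionError_of_weak_signal hφ_mono h0 h1 hφ_zero hprob hξ hθ
      le_rfl hν_card (EReal.tendsto_coe.1 hSNR)
  · by_contra hO
    obtain ⟨M, hM⟩ := hR.bound
    -- Failure of `√L = O(θ)` defeats every constant `n` infinitely often. A diagonal subsequence
    -- has `θ / √L < 1 / n` at its positive `n`-th terms, so bounded `R` makes `θ R / √L` tend to
    -- zero there.
    have hfreq : ∀ n : ℕ, ∃ᶠ L : ℕ in atTop, n * θ L < √(L : ℝ) := by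
      intro n hn
      refine hO (Asymptotics.IsBigO.of_bound n (hn.mono fun L hL => ?_))
      rw [Real.norm_of_nonneg (Real.sqrt_nonneg _), Real.norm_of_nonneg (hθ L).le]
      exact not_lt.1 hL
    obtain ⟨f, hf, hfθ⟩ := extraction_forall_of_frequently hfreq
    have hsub : map f atTop ≤ atTop := hf.tendsto_atTop
    have hr : Tendsto (fun L : ℕ => θ L * (R L : ℝ) / √(L : ℝ)) (map f atTop) (𝓝 0) := by
      rw [tendsto_map'_iff]
      refine squeeze_zero' (.of_forall fun n => ?_) ?_ (tendsto_const_div_atTop_nhds_zero_nat M)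
      · exact div_nonneg (mul_nonneg (hθ _).le (Nat.cast_nonneg _)) (Real.sqrt_nonneg _)
      · filter_upwards [hf.tendsto_atTop.eventually hM, eventually_gt_atTop 0] with n hn hn0
        simp only [RCLike.norm_natCast, norm_one, mul_one] at hn
        have hn0' : (0 : ℝ) < n := by exact_mod_cast hn0
        have hpos : 0 < √((f n : ℕ) : ℝ) := (mul_pos hn0' (hθ (f n))).trans (hfθ n)
        have hM0 : 0 ≤ M := (Nat.cast_nonneg _).trans hn
        simp only [Function.comp]
        rw [div_le_div_iff₀ hpos hn0']
        calc θ (f n) * R (f n) * n = R (f n) * (n * θ (f n)) := by ring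
          _ ≤ M * √(f n : ℝ) := by
            exact mul_le_mul hn (hfθ n).le (mul_nonneg hn0'.le (hθ _).le) hM0
    have hlow := SparseToken.tendsto_approxAttentionError_of_weak_signal (ξ := ξ) hφ_mono h0 h1
      hφ_zero hprob hξ hθ hsub (hsub hν_card) hr
    -- Along the subsequence the error would tend both to zero and to the positive number `min prob
    -- (1 - prob)`.
    have h := tendsto_nhds_unique hlow (hlim.mono_left hsub)
    exact absurd h (lt_min hprob.1 (sub_pos.2 hprob.2)).ne'
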